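/- Robust fault-tolerant facility location. Let $k\ge 1$ be a fixed integer and put $\gamma=k+5+4/k$. An instance consists of a finite set $\mathcal F$ of facilities with $|\mathcal F|>k$, a finite set $\mathcal C$ of clients, opening costs $f_i\ge 0$, and connection costs $c_{ij}$ that are the facility–client distances of a (pseudo)metric on $\mathcal F\sqcup\mathcal C$. If a set $S\subseteq\mathcal F$ is opened, an adversary, knowing $S$, closes a set $A\subseteq S$ with $|A|\le k$, and every client is connected to the closest facility of $S\setminus A$. The cost of $S$ is $$\mathrm{cost}(S)=\sum_{i\in S}f_i+\max_{A\subseteq S,\ |A|\le k}\ \sum_{j\in\mathcal C}\ \min_{i\in S\setminus A}c_{ij},$$ where $\min\emptyset=\infty$, and $\mathrm{OPT}=\min_S \mathrm{cost}(S)$. Consider the linear program with one scenario for each set $A\subseteq\mathcal F$ of exactly $k$ facilities: $$\text{minimize}\quad \mathrm{LP}(x,y)=\sum_i f_iy_i+\max_A\sum_j C_{(j,A)},\qquad C_{(j,A)}=\sum_i c_{ij}x_{A,ij},$$ subject to $\sum_i x_{A,ij}\ge 1$ and $x_{A,ij}\le y_i$ for all $A,i,j$, $x_{A,ij}=0$ for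 $i\in A$, and $x,y\ge 0$. There are an LP-rounding routine, depending only on $k$, and a polynomial $p$, depending only on $k$, such that, given an instance and any feasible solution $(x,y)$ of the linear program (with the scenarios listed in any order), the routine performs at most $p(|\mathcal F|+|\mathcal C|)$ elementary steps on a random access machine (additions, subtractions, comparisons, and memory accesses) and outputs a set $S$ of facilities to open with the following properties. 1. With the scaled opening variables $\overline y_i=\min\{1,\gamma y_i\}$ one has $\sum_{i\in S}f_i\le\sum_i f_i\overline y_i$. 2. For every scenario $A$ and client $j$: either some opened facility $i\in S\setminus A$ with $\overline y_i=1$ satisfies $c_{ij}\le\frac{\gamma}{3}C_{(j,A)}$, or at least $k+1$ opened facilities are within distance $\gamma\, C_{(j,A)}$ of $j$. 3. Consequently, for every scenario $A$ and client $j$ there is an opened facility $i\in S\setminus A$ with $c_{ij}\le\gamma\, C_{(j,A)}$. 4. $\mathrm{cost}(S)\le\gamma\cdot\mathrm{LP}(x,y)$; and if $(x,y)$ is an optimal solution of the linear program, then $\mathrm{cost}(S)\le\gamma\cdot\mathrm{OPT}$. That is, rounding an optimal fractional solution is a $(k+5+4/k)$-approximation. -/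

import Mathlib

namespace RFTFL

/-! ### Robust fault-tolerant facility location -/

/-- A facility location instance: opening costs, and connection costs which are the
client-facility distances of a (pseudo)metric on the disjoint union of facilities and clients
(a facility and a client may share a location). -/
structure Instance (F C : Type) where
  f : F → ℝ
  c : F → C → ℝ
  f_nonneg : ∀ i, 0 ≤ f i
  metric : ∃ d : PseudoMetricSpace (F ⊕ C), ∀ i j, c i j = d.dist (Sum.inl i) (Sum.inr j)

/-- The scenarios of the linear program: the sets of exactly `k` facilities. -/
abbrev Scenario (F : Type) (k : ℕ) : Type := {A : Finset F // A.card = k}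

/-- The factor `k + 5 + 4 / k`. -/
noncomputable def ratio (k : ℕ) : ℝ := (k : ℝ) + 5 + 4 / (k : ℝ)

namespace Instance

variable {F C : Type} [Fintype F] [DecidableEq F] [Fintype C]

/-- Cost of opening exactly the facilities in `S`: the opening costs plus the largest
total connection cost that an adversary can enforce by closing a set `A` of at most `k` opened
facilities, each client being connected to the closest facility of `S \ A`.
The cost is `∞` if there is a client and the adversary can close all of `S`. -/
noncomputable def robustCost (I : Instance F C) (k : ℕ) (S : Finset F) : ENNReal :=
  ∑ i ∈ S, ENNReal.ofReal (I.f i) +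
    ⨆ (A : Finset F) (_ : A ⊆ S ∧ A.card ≤ k),
      ∑ j : C, ⨅ i ∈ S \ A, ENNReal.ofReal (I.c i j)

/-- The optimal value of the robust fault-tolerant facility location problem. -/
noncomputable def opt (I : Instance F C) (k : ℕ) : ENNReal :=
  ⨅ S : Finset F, I.robustCost k S

/-- Feasibility of a fractional solution of the linear programming relaxation. -/
structure LPFeasible (I : Instance F C) (k : ℕ)
    (x : Scenario F k → F → C → ℝ) (y : F → ℝ) : Prop where
  cover : ∀ A j, 1 ≤ ∑ i, x A i j
  le_open : ∀ A i j, x A i j ≤ y i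
  closed : ∀ (A : Scenario F k), ∀ i ∈ A.1, ∀ j, x A i j = 0
  x_nonneg : ∀ A i j, 0 ≤ x A i j
  y_nonneg : ∀ i, 0 ≤ y i

/-- The fractional connection cost `C_(j,A)` of client `j` in scenario `A`. -/
def fracCost (I : Instance F C) {k : ℕ} (x : Scenario F k → F → C → ℝ)
    (A : Scenario F k) (j : C) : ℝ :=
  ∑ i, I.c i j * x A i j

/-- The objective of the linear program; the supremum is a maximum over finitely many scenarios
(there is at least one as soon as `k ≤ |F|`). -/
noncomputable def lpCost (I : Instance F C) {k : ℕ} (x : Scenario F k → F → C → ℝ)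
    (y : F → ℝ) : ℝ :=
  ∑ i, I.f i * y i + ⨆ A : Scenario F k, ∑ j, I.fracCost x A j

/-- Optimal fractional solutions. -/
def LPOptimal (I : Instance F C) (k : ℕ) (x : Scenario F k → F → C → ℝ) (y : F → ℝ) : Prop :=
  I.LPFeasible k x y ∧ ∀ x' y', I.LPFeasible k x' y' → I.lpCost x y ≤ I.lpCost x' y'

end Instance

/-! ### The machine model

Programs with bounded loops over a random access memory.  There are index variables holding
natural numbers and three-dimensional tables of real numbers.  The only arithmetic operations are
addition and (for reals) subtraction; tests compare two indices or two reals.  Every arithmetic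
operation, constant, table access, test, assignment and loop iteration is charged.  Since there is
no multiplication, on rational inputs all numbers that occur within `T` steps have bit length
polynomial in `T` and the input length, so polynomially many steps also mean polynomial time in
the usual sense. -/

/-- Memory contents. -/
structure State where
  idx : ℕ → ℕ
  tab : ℕ → ℕ → ℕ → ℕ → ℝ

/-- Index expressions. -/
inductive NExp where
  | const (a : ℕ)
  | var (v : ℕ)
  | add (a b : NExp)

/-- Real expressions; `get t a b c` reads entry `(a, b, c)` of table `t`. -/
inductive RExp where
  | const (q : ℚ)
  | get (t : ℕ) (a b c : NExp)
  | add (a b : RExp)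
  | sub (a b : RExp)

/-- Tests. -/
inductive BExp where
  | nlt (a b : NExp)
  | rlt (a b : RExp)
  | neg (a : BExp)
  | and (a b : BExp)

/-- Programs. -/
inductive Cmd where
  | skip
  | assign (v : ℕ) (e : NExp)
  | store (t : ℕ) (a b c : NExp) (e : RExp)
  | seq (p q : Cmd)
  | ite (b : BExp) (p q : Cmd)
  /-- For `v = 0, 1, …, N - 1` do `p`, where `N` is the value of `e` on entry. -/
  | loop (v : ℕ) (e : NExp) (p : Cmd)

def NExp.eval (σ : State) : NExp → ℕ
  | .const a => a
  | .var v => σ.idx v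
  | .add a b => a.eval σ + b.eval σ

def NExp.cost : NExp → ℕ
  | .const _ => 1
  | .var _ => 1
  | .add a b => a.cost + b.cost + 1

noncomputable def RExp.eval (σ : State) : RExp → ℝ
  | .const q => (q : ℝ)
  | .get t a b c => σ.tab t (a.eval σ) (b.eval σ) (c.eval σ)
  | .add a b => a.eval σ + b.eval σ
  | .sub a b => a.eval σ - b.eval σ

def RExp.cost : RExp → ℕ
  | .const _ => 1
  | .get _ a b c => a.cost + b.cost + c.cost + 1
  | .add a b => a.cost + b.cost + 1
  | .sub a b => a.cost + b.cost + 1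

def BExp.eval (σ : State) : BExp → Prop
  | .nlt a b => a.eval σ < b.eval σ
  | .rlt a b => a.eval σ < b.eval σ
  | .neg a => ¬ a.eval σ
  | .and a b => a.eval σ ∧ b.eval σ

def BExp.cost : BExp → ℕ
  | .nlt a b => a.cost + b.cost + 1
  | .rlt a b => a.cost + b.cost + 1
  | .neg a => a.cost + 1
  | .and a b => a.cost + b.cost + 1

/-- Assign the value `a` to the index variable `v`. -/
def State.setIdx (σ : State) (v a : ℕ) : State :=
  { σ with idx := Function.update σ.idx v a }

/-- Write `r` into entry `(a, b, c)` of table `t`. -/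
noncomputable def State.setTab (σ : State) (t a b c : ℕ) (r : ℝ) : State :=
  { σ with tab := fun t' a' b' c' =>
      if t' = t ∧ a' = a ∧ b' = b ∧ c' = c then r else σ.tab t' a' b' c' }

open Classical in
/-- Run a program: the final memory and the number of steps. -/
noncomputable def Cmd.run : Cmd → State → State × ℕ
  | .skip, σ => (σ, 1)
  | .assign v e, σ => (σ.setIdx v (e.eval σ), e.cost + 1)
  | .store t a b c e, σ =>
      (σ.setTab t (a.eval σ) (b.eval σ) (c.eval σ) (e.eval σ),
        a.cost + b.cost + c.cost + e.cost + 1)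
  | .seq p q, σ => ((q.run (p.run σ).1).1, (p.run σ).2 + (q.run (p.run σ).1).2)
  | .ite b p q, σ =>
      if b.eval σ then ((p.run σ).1, (p.run σ).2 + b.cost + 1)
      else ((q.run σ).1, (q.run σ).2 + b.cost + 1)
  | .loop v e p, σ =>
      (List.range (e.eval σ)).foldl
        (fun acc i => ((p.run (acc.1.setIdx v i)).1, acc.2 + (p.run (acc.1.setIdx v i)).2 + 1))
        (σ, e.cost + 1)

/-- The input memory.  Index variables `0`, `1`, `2` hold the numbers of facilities, of clients
and of scenarios; tables `0`, `1`, `2`, `3` hold `f`, `c`, `y` and `x`, the scenarios being listed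
in the order `e`.  Everything else is zero. -/
noncomputable def encode {n m k : ℕ} (I : Instance (Fin n) (Fin m))
    (e : Fin (n.choose k) ≃ Scenario (Fin n) k)
    (x : Scenario (Fin n) k → Fin n → Fin m → ℝ) (y : Fin n → ℝ) : State where
  idx v := if v = 0 then n else if v = 1 then m else if v = 2 then n.choose k else 0
  tab t a b c :=
    if t = 0 then (if h : a < n ∧ b = 0 ∧ c = 0 then I.f ⟨a, h.1⟩ else 0)
    else if t = 1 then (if h : a < n ∧ b < m ∧ c = 0 then I.c ⟨a, h.1⟩ ⟨b, h.2.1⟩ else 0)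
    else if t = 2 then (if h : a < n ∧ b = 0 ∧ c = 0 then y ⟨a, h.1⟩ else 0)
    else if t = 3 then
      (if h : a < n.choose k ∧ b < n ∧ c < m then
        x (e ⟨a, h.1⟩) ⟨b, h.2.1⟩ ⟨c, h.2.2⟩ else 0)
    else 0

open Classical in
/-- The set of opened facilities, read off from table `4`: facility `i` is open if and only if
entry `(i, 0, 0)` is `1`. -/
noncomputable def output (n : ℕ) (σ : State) : Finset (Fin n) :=
  Finset.univ.filter fun i => σ.tab 4 i 0 0 = 1

end RFTFL

namespace RFTFL

theorem Cmd.run_loop_induction {v : ℕ} {e : NExp} {p : Cmd} {σ : State}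
    (Inv : ℕ → State × ℕ → Prop) (h0 : Inv 0 (σ, e.cost + 1))
    (hs : ∀ i < e.eval σ, ∀ acc, Inv i acc →
      Inv (i + 1) ((p.run (acc.1.setIdx v i)).1, acc.2 + (p.run (acc.1.setIdx v i)).2 + 1)) :
    Inv (e.eval σ) ((Cmd.loop v e p).run σ) := by
  rw [Cmd.run]
  generalize e.eval σ = N at hs
  induction N with
  | zero => simpa using h0
  | succ N ih =>
    rw [List.range_succ, List.foldl_append]
    exact hs N (Nat.lt_succ_self N) _ (ih fun i hi => hs i (hi.trans (Nat.lt_succ_self N)))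

/-- Loop rule for the final memory. -/
theorem Cmd.run_loop_inv {v : ℕ} {e : NExp} {p : Cmd} {σ : State} {N : ℕ} (hN : e.eval σ = N)
    (Inv : ℕ → State → Prop) (h0 : Inv 0 σ)
    (hs : ∀ i < N, ∀ τ, Inv i τ → Inv (i + 1) (p.run (τ.setIdx v i)).1) :
    Inv N ((Cmd.loop v e p).run σ).1 := by
  subst hN
  exact Cmd.run_loop_induction (fun i acc => Inv i acc.1) h0 fun i hi acc h => hs i hi _ h

/-- A loop whose iterations preserve `Good`, never undo an achieved goal `Done t`, and achieve the
goals in `T i` achieves all of these goals. -/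
theorem Cmd.run_loop_done {α : Type*} {v : ℕ} {e : NExp} {p : Cmd} {σ : State} {N : ℕ}
    (hN : e.eval σ = N) {Good : State → Prop} {Done : α → State → Prop} {T : ℕ → Set α}
    (hs : ∀ i < N, ∀ τ, Good τ → Good (p.run (τ.setIdx v i)).1 ∧
      (∀ t ∈ T i, Done t (p.run (τ.setIdx v i)).1) ∧
      ∀ t, Done t τ → Done t (p.run (τ.setIdx v i)).1) (h0 : Good σ) :
    Good ((Cmd.loop v e p).run σ).1 ∧
      (∀ i < N, ∀ t ∈ T i, Done t ((Cmd.loop v e p).run σ).1) ∧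
      ∀ t, Done t σ → Done t ((Cmd.loop v e p).run σ).1 := by
  refine Cmd.run_loop_inv hN (fun s τ => Good τ ∧ (∀ i < s, ∀ t ∈ T i, Done t τ) ∧
    ∀ t, Done t σ → Done t τ) ⟨h0, by simp, fun t h => h⟩ ?_
  rintro i hi τ ⟨hg, hd, hk⟩
  obtain ⟨h1, h2, h3⟩ := hs i hi τ hg
  refine ⟨h1, fun i' hi' t ht => ?_, fun t ht => h3 t (hk t ht)⟩
  rcases Nat.lt_succ_iff_lt_or_eq.1 hi' with h | rfl
  · exact h3 t (hd i' h t ht)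
  · exact h2 t ht

@[simp] theorem Cmd.run_skip (σ : State) : (Cmd.skip.run σ).1 = σ := by rw [Cmd.run]

@[simp] theorem Cmd.run_assign (v : ℕ) (e : NExp) (σ : State) :
    ((Cmd.assign v e).run σ).1 = σ.setIdx v (e.eval σ) := by rw [Cmd.run]

@[simp] theorem Cmd.run_store (t : ℕ) (a b c : NExp) (e : RExp) (σ : State) :
    ((Cmd.store t a b c e).run σ).1 =
      σ.setTab t (a.eval σ) (b.eval σ) (c.eval σ) (e.eval σ) := by rw [Cmd.run]

@[simp] theorem Cmd.run_seq (p q : Cmd) (σ : State) :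
    ((Cmd.seq p q).run σ).1 = (q.run (p.run σ).1).1 := by rw [Cmd.run]

theorem Cmd.run_ite_pos {b : BExp} {p q : Cmd} {σ : State} (h : b.eval σ) :
    ((Cmd.ite b p q).run σ).1 = (p.run σ).1 := by rw [Cmd.run, if_pos h]

theorem Cmd.run_ite_neg {b : BExp} {p q : Cmd} {σ : State} (h : ¬ b.eval σ) :
    ((Cmd.ite b p q).run σ).1 = (q.run σ).1 := by rw [Cmd.run, if_neg h]

@[simp] theorem State.setIdx_idx (σ : State) (v a w : ℕ) :
    (σ.setIdx v a).idx w = if w = v then a else σ.idx w := by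
  simp [State.setIdx, Function.update_apply]

@[simp] theorem State.setIdx_tab (σ : State) (v a : ℕ) : (σ.setIdx v a).tab = σ.tab := rfl

@[simp] theorem State.setTab_idx (σ : State) (t a b c : ℕ) (r : ℝ) :
    (σ.setTab t a b c r).idx = σ.idx := rfl

theorem State.setTab_tab (σ : State) (t a b c : ℕ) (r : ℝ) (t' a' b' c' : ℕ) :
    (σ.setTab t a b c r).tab t' a' b' c' =
      if t' = t ∧ a' = a ∧ b' = b ∧ c' = c then r else σ.tab t' a' b' c' := rfl

/-- Whether a program may change index variable `w`. -/
def Cmd.setsIdx (w : ℕ) : Cmd → Bool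
  | .skip => false
  | .assign v _ => v == w
  | .store _ _ _ _ _ => false
  | .seq p q => p.setsIdx w || q.setsIdx w
  | .ite _ p q => p.setsIdx w || q.setsIdx w
  | .loop v _ p => v == w || p.setsIdx w

theorem Cmd.run_idx {w : ℕ} (p : Cmd) (h : p.setsIdx w = false) (σ : State) :
    (p.run σ).1.idx w = σ.idx w := by
  induction p generalizing σ with
  | skip => simp
  | assign v e =>
    have : w ≠ v := by rintro rfl; simp [Cmd.setsIdx] at h
    simp [this]
  | store t a b c e => simp
  | seq p q hp hq =>
    simp only [Cmd.setsIdx, Bool.or_eq_false_iff] at h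
    simp [hp h.1, hq h.2]
  | ite b p q hp hq =>
    simp only [Cmd.setsIdx, Bool.or_eq_false_iff] at h
    by_cases hb : b.eval σ
    · rw [Cmd.run_ite_pos hb, hp h.1]
    · rw [Cmd.run_ite_neg hb, hq h.2]
  | loop v e p hp =>
    simp only [Cmd.setsIdx, Bool.or_eq_false_iff, beq_eq_false_iff_ne] at h
    refine Cmd.run_loop_inv rfl (fun _ τ => τ.idx w = σ.idx w) rfl fun i _ τ hτ => ?_
    simp [hp h.2, h.1.symm, hτ]

/-- All loop bounds are input sizes, which are never changed. -/
def Cmd.InputBounded : Cmd → Prop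
  | .skip => True
  | .assign v _ => 3 ≤ v
  | .store _ _ _ _ _ => True
  | .seq p q => p.InputBounded ∧ q.InputBounded
  | .ite _ p q => p.InputBounded ∧ q.InputBounded
  | .loop v e p => 3 ≤ v ∧ (∃ u < 3, e = .var u) ∧ p.InputBounded

/-- A bound on the number of steps in terms of a bound on the input sizes. -/
noncomputable def Cmd.timePoly : Cmd → Polynomial ℕ
  | .skip => 1
  | .assign _ e => ((e.cost + 1 : ℕ) : Polynomial ℕ)
  | .store _ a b c e => ((a.cost + b.cost + c.cost + e.cost + 1 : ℕ) : Polynomial ℕ)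
  | .seq p q => p.timePoly + q.timePoly
  | .ite b p q => p.timePoly + q.timePoly + ((b.cost + 1 : ℕ) : Polynomial ℕ)
  | .loop _ e p => ((e.cost + 1 : ℕ) : Polynomial ℕ) + Polynomial.X * (p.timePoly + 1)

theorem Cmd.InputBounded.setsIdx {p : Cmd} (h : p.InputBounded) {w : ℕ} (hw : w < 3) :
    p.setsIdx w = false := by
  induction p with
  | skip => rfl
  | assign v e =>
    have h : 3 ≤ v := h
    simp [Cmd.setsIdx]; omega
  | store t a b c e => rfl
  | seq p q hp hq => simp [Cmd.setsIdx, hp h.1, hq h.2]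
  | ite b p q hp hq => simp [Cmd.setsIdx, hp h.1, hq h.2]
  | loop v e p hp =>
    have h1 : 3 ≤ v := h.1
    simp [Cmd.setsIdx, hp h.2.2]; omega

theorem Cmd.run_time_le {p : Cmd} (h : p.InputBounded) {σ : State} {B : ℕ}
    (hB : ∀ u < 3, σ.idx u ≤ B) : (p.run σ).2 ≤ p.timePoly.eval B := by
  induction p generalizing σ with
  | skip => simp [Cmd.run, Cmd.timePoly]
  | assign v e => simp only [Cmd.run, Cmd.timePoly, Polynomial.eval_natCast]; exact le_rfl
  | store t a b c e => simp only [Cmd.run, Cmd.timePoly, Polynomial.eval_natCast]; exact le_rfl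
  | seq p q hp hq =>
    simp only [Cmd.run, Cmd.timePoly, Polynomial.eval_add]
    refine Nat.add_le_add (hp h.1 hB) (hq h.2 fun u hu => ?_)
    rw [Cmd.run_idx p (h.1.setsIdx hu)]
    exact hB u hu
  | ite b p q hp hq =>
    have h1 := hp h.1 hB
    have h2 := hq h.2 hB
    rw [Cmd.run]
    simp only [Cmd.timePoly, Polynomial.eval_add, Polynomial.eval_natCast, Nat.cast_id]
    split_ifs <;> dsimp only <;> omega
  | loop v e p hp =>
    obtain ⟨hv, ⟨u, hu, rfl⟩, hb⟩ := h
    have key := Cmd.run_loop_induction (v := v) (e := .var u) (p := p) (σ := σ)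
      (fun i acc => (∀ u < 3, acc.1.idx u ≤ B) ∧
        acc.2 ≤ (NExp.var u).cost + 1 + i * (p.timePoly.eval B + 1)) ⟨hB, by simp⟩ ?_
    · refine key.2.trans ?_
      simp only [Cmd.timePoly, Polynomial.eval_add, Polynomial.eval_natCast, Nat.cast_id,
        Polynomial.eval_mul, Polynomial.eval_X, Polynomial.eval_one]
      exact Nat.add_le_add_left (Nat.mul_le_mul_right _ (hB u hu)) _
    · rintro i - acc ⟨hi, ht⟩
      have hs : ∀ u < 3, (acc.1.setIdx v i).idx u ≤ B := fun w hw => by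
        rw [State.setIdx_idx, if_neg (by omega)]
        exact hi w hw
      refine ⟨fun w hw => ?_, ?_⟩
      · rw [Cmd.run_idx p (hb.setsIdx hw)]
        exact hs w hw
      · have := hp hb hs
        dsimp only
        rw [add_mul]
        omega

end RFTFL

namespace RFTFL
open Finset

/-- The order by cost, ties being broken by the index. -/
def Before (f : ℕ → ℝ) (i i' : ℕ) : Prop := f i < f i' ∨ (f i ≤ f i' ∧ i < i')

theorem Before.le {f : ℕ → ℝ} {i i' : ℕ} (h : Before f i i') : f i ≤ f i' :=
  h.elim le_of_lt And.left

theorem Before.irrefl (f : ℕ → ℝ) (i : ℕ) : ¬ Before f i i := by simp [Before]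

theorem Before.trans {f : ℕ → ℝ} {i j l : ℕ} (h : Before f i j) (h' : Before f j l) :
    Before f i l := by
  rcases h with h | ⟨h, h1⟩ <;> rcases h' with h' | ⟨h', h2⟩
  · exact .inl (h.trans h')
  · exact .inl (h.trans_le h')
  · exact .inl (h.trans_lt h')
  · exact .inr ⟨h.trans h', h1.trans h2⟩

theorem before_or_before (f : ℕ → ℝ) {i j : ℕ} (h : i ≠ j) : Before f i j ∨ Before f j i := by
  rcases lt_trichotomy (f i) (f j) with h1 | h1 | h1
  · exact .inl (.inl h1)
  · rcases lt_or_gt_of_ne h with h2 | h2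
    · exact .inl (.inr ⟨h1.le, h2⟩)
    · exact .inr (.inr ⟨h1.ge, h2⟩)
  · exact .inr (.inl h1)

open scoped Classical in
/-- The number of elements of `B` that come before `i`. -/
noncomputable def rank (f : ℕ → ℝ) (B : Finset ℕ) (i : ℕ) : ℕ := #{i' ∈ B | Before f i' i}

open scoped Classical in
theorem rank_lt_rank {f : ℕ → ℝ} {B : Finset ℕ} {i j : ℕ} (hi : i ∈ B) (h : Before f i j) :
    rank f B i < rank f B j := by
  refine card_lt_card ⟨fun l hl => ?_, fun hs => ?_⟩
  · simp only [mem_filter] at hl ⊢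
    exact ⟨hl.1, hl.2.trans h⟩
  · have := hs (mem_filter.2 ⟨hi, h⟩)
    exact Before.irrefl f i (mem_filter.1 this).2

/-- The `q` cheapest elements of `B`. -/
noncomputable def cheapest (f : ℕ → ℝ) (q : ℕ) (B : Finset ℕ) : Finset ℕ :=
  {i ∈ B | rank f B i < q}

theorem cheapest_subset (f : ℕ → ℝ) (q : ℕ) (B : Finset ℕ) : cheapest f q B ⊆ B :=
  filter_subset _ _

open scoped Classical in
theorem card_cheapest {f : ℕ → ℝ} {q : ℕ} {B : Finset ℕ} (h : q ≤ #B) : #(cheapest f q B) = q := by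
  have hinj : Set.InjOn (rank f B) B := by
    intro i hi j hj hij
    by_contra hne
    rcases before_or_before f hne with h | h
    · exact (rank_lt_rank hi h).ne hij
    · exact (rank_lt_rank hj h).ne' hij
  have himg : B.image (rank f B) = range #B := by
    refine eq_of_subset_of_card_le (fun r hr => ?_) (by rw [card_image_of_injOn hinj, card_range])
    obtain ⟨i, hi, rfl⟩ := mem_image.1 hr
    refine mem_range.2 (card_lt_card ⟨filter_subset _ _, fun hs => ?_⟩)
    exact Before.irrefl f i (mem_filter.1 (hs hi)).2
  have h2 : (cheapest f q B).image (rank f B) = range q := by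
    ext r
    simp only [cheapest, mem_image, mem_filter, mem_range]
    constructor
    · rintro ⟨i, hi, rfl⟩
      exact hi.2
    · intro hr
      have : r ∈ B.image (rank f B) := by rw [himg]; exact mem_range.2 (hr.trans_le h)
      obtain ⟨i, hi, rfl⟩ := mem_image.1 this
      exact ⟨i, ⟨hi, hr⟩, rfl⟩
  have h3 := card_image_of_injOn (hinj.mono (coe_subset.2 (cheapest_subset f q B)))
  rwa [h2, card_range, eq_comm] at h3

theorem le_of_mem_cheapest {f : ℕ → ℝ} {q : ℕ} {B : Finset ℕ} {i j : ℕ}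
    (hi : i ∈ cheapest f q B) (hj : j ∈ B \ cheapest f q B) : f i ≤ f j := by
  simp only [cheapest, mem_sdiff, mem_filter, not_and, not_lt] at hi hj
  by_contra! hlt
  exact ((rank_lt_rank hj.1 (.inl hlt)).trans (hi.2.trans_le (hj.2 hj.1))).false

/-- Integrally opening the `q` cheapest elements costs at most any fractional opening of total
weight at least `q`. -/
theorem sum_cheapest_le {f g : ℕ → ℝ} {q : ℕ} {B : Finset ℕ} (hf : ∀ i ∈ B, 0 ≤ f i)
    (hg0 : ∀ i ∈ B, 0 ≤ g i) (hg1 : ∀ i ∈ B, g i ≤ 1) (hq : (q : ℝ) ≤ ∑ i ∈ B, g i) :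
    q ≤ #B ∧ ∑ i ∈ cheapest f q B, f i ≤ ∑ i ∈ B, f i * g i := by
  have hcard : q ≤ #B := by
    have := hq.trans (sum_le_sum hg1)
    simpa using this
  refine ⟨hcard, ?_⟩
  rcases (cheapest f q B).eq_empty_or_nonempty with h0 | hne
  · rw [h0, sum_empty]
    exact sum_nonneg fun i hi => mul_nonneg (hf i hi) (hg0 i hi)
  have hsub := cheapest_subset f q B
  obtain ⟨l, hl, hmax⟩ := exists_max_image _ f hne
  have hsplit := sum_sdiff (f := g) hsub
  have hc : ((#(cheapest f q B) : ℕ) : ℝ) = q := by rw [card_cheapest hcard]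
  have h1 : ∑ i ∈ cheapest f q B, f i * (1 - g i) ≤ ∑ i ∈ cheapest f q B, f l * (1 - g i) :=
    sum_le_sum fun i hi =>
      mul_le_mul_of_nonneg_right (hmax i hi) (sub_nonneg.2 (hg1 i (hsub hi)))
  have h2 : ∑ i ∈ B \ cheapest f q B, f l * g i ≤ ∑ i ∈ B \ cheapest f q B, f i * g i :=
    sum_le_sum fun i hi =>
      mul_le_mul_of_nonneg_right (le_of_mem_cheapest hl hi) (hg0 i (mem_sdiff.1 hi).1)
  rw [← mul_sum, sum_sub_distrib, sum_const, nsmul_eq_mul, mul_one, hc] at h1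
  rw [← mul_sum] at h2
  simp only [mul_sub, mul_one, sum_sub_distrib] at h1
  have h3 := sum_sdiff (f := fun i => f i * g i) hsub
  have h4 := mul_le_mul_of_nonneg_left hq (hf l (hsub hl))
  rw [← hsplit] at h4
  simp only [mul_add] at *
  linarith

/-- The invariant of greedy clustering: `O` is open, `U` is used up, the elements of `L` are open
from the start, and `V` is the set of clusters under consideration. -/
structure Clustering {ι : Type*} (f g : ℕ → ℝ) (q : ℕ) (L : Finset ℕ) (V : Set ι)
    (ball : ι → Finset ℕ) (rad : ι → ℝ) (O U : Finset ℕ) : Prop where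
  full : L ⊆ O
  sub : O ⊆ U
  cost : ∑ i ∈ O, f i ≤ ∑ i ∈ U, f i * g i
  near : ∀ t ∈ V, (∃ i ∈ ball t, i ∈ U) → (∃ i ∈ ball t, i ∈ L) ∨
    ∃ t' ∈ V, rad t' ≤ rad t ∧ (∃ i ∈ ball t, i ∈ ball t') ∧ q ≤ #(O ∩ ball t')

variable {ι : Type*} {f g : ℕ → ℝ} {q : ℕ} {L : Finset ℕ} {V : Set ι}
  {ball : ι → Finset ℕ} {rad : ι → ℝ} {O U : Finset ℕ}

theorem Clustering.init (hg : ∀ i ∈ L, g i = 1) : Clustering f g q L V ball rad L L where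
  full := subset_rfl
  sub := subset_rfl
  cost := (sum_congr rfl fun i hi => by rw [hg i hi, mul_one]).le
  near := fun _ _ h => .inl h

theorem Clustering.step (h : Clustering f g q L V ball rad O U) {t : ι} (ht : t ∈ V)
    (hdisj : ∀ i ∈ ball t, i ∉ U)
    (hmin : ∀ t' ∈ V, (∀ i ∈ ball t', i ∉ U) → rad t ≤ rad t')
    (hf : ∀ i ∈ ball t, 0 ≤ f i) (hg0 : ∀ i ∈ ball t, 0 ≤ g i) (hg1 : ∀ i ∈ ball t, g i ≤ 1)
    (hq : (q : ℝ) ≤ ∑ i ∈ ball t, g i) :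
    Clustering f g q L V ball rad (O ∪ cheapest f q (ball t)) (U ∪ ball t) := by
  obtain ⟨hcard, hcost⟩ := sum_cheapest_le hf hg0 hg1 hq
  have hsub := cheapest_subset f q (ball t)
  refine ⟨h.full.trans subset_union_left, union_subset_union h.sub hsub, ?_, ?_⟩
  · rw [sum_union, sum_union]
    · exact add_le_add h.cost hcost
    · exact disjoint_left.2 fun i hi hi' => hdisj i hi' hi
    · exact disjoint_left.2 fun i hi hi' => hdisj i (hsub hi') (h.sub hi)
  · intro t₁ ht₁ hhit
    by_cases hU : ∃ i ∈ ball t₁, i ∈ U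
    · refine (h.near t₁ ht₁ hU).imp id ?_
      rintro ⟨t', h1, h2, h3, h4⟩
      exact ⟨t', h1, h2, h3, h4.trans (card_le_card (inter_subset_inter_right subset_union_left))⟩
    · push Not at hU
      obtain ⟨i, hi, hi'⟩ := hhit
      refine .inr ⟨t, ht, hmin t₁ ht₁ hU, ⟨i, hi, (mem_union.1 hi').resolve_left (hU i hi)⟩, ?_⟩
      exact (card_cheapest (f := f) hcard).symm.le.trans
        (card_le_card (subset_inter subset_union_right hsub))

end RFTFL

namespace RFTFL
open Finset

/-- The numerical data of an instance and a fractional solution, indexed by natural numbers. -/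
structure Data where
  n : ℕ
  m : ℕ
  N : ℕ
  f : ℕ → ℝ
  c : ℕ → ℕ → ℝ
  y : ℕ → ℝ
  x : ℕ → ℕ → ℕ → ℝ

namespace Data

/-- The ball of a triple (scenario, client, facility): the facilities that serve the client in the
scenario and are at most as far from it as the given one. -/
noncomputable def ball (D : Data) (t : ℕ × ℕ × ℕ) : Finset ℕ :=
  {i ∈ range D.n | 0 < D.x t.1 i t.2.1 ∧ D.c i t.2.1 ≤ D.c t.2.2 t.2.1}

/-- The radius of the ball of a triple. -/
def rad (D : Data) (t : ℕ × ℕ × ℕ) : ℝ := D.c t.2.2 t.2.1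

/-- The fraction of the client's demand that is served within the radius of a triple. -/
noncomputable def mass (D : Data) (t : ℕ × ℕ × ℕ) : ℝ :=
  ∑ i ∈ range D.n, if D.c i t.2.1 ≤ D.rad t then D.x t.1 i t.2.1 else 0

/-- The triples whose balls serve at least a fraction `θ` of the demand. -/
def heavy (D : Data) (θ : ℝ) : Set (ℕ × ℕ × ℕ) :=
  {t | t.1 < D.N ∧ t.2.1 < D.m ∧ t.2.2 < D.n ∧ θ ≤ D.mass t}

/-- The facilities that are opened from the start. -/
noncomputable def full (D : Data) (k : ℕ) : Finset ℕ :=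
  {i ∈ range D.n | (k : ℝ) ≤ ((k + 1) * (k + 4) : ℕ) * D.y i}

/-- The memory contains the data `D`, the open facilities `O` and the used facilities `U`. -/
structure Holds (D : Data) (O U : Finset ℕ) (σ : State) : Prop where
  n : σ.idx 0 = D.n
  m : σ.idx 1 = D.m
  N : σ.idx 2 = D.N
  f : ∀ i, σ.tab 0 i 0 0 = D.f i
  c : ∀ i j, σ.tab 1 i j 0 = D.c i j
  y : ∀ i, σ.tab 2 i 0 0 = D.y i
  x : ∀ a i j, σ.tab 3 a i j = D.x a i j
  opened : ∀ i, σ.tab 4 i 0 0 = if i ∈ O then 1 else 0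
  used : ∀ i, σ.tab 6 i 0 0 = if i ∈ U then 1 else 0

variable {D : Data} {O U : Finset ℕ} {σ : State}

theorem Holds.setIdx (h : D.Holds O U σ) {v : ℕ} (hv : 3 ≤ v) (a : ℕ) :
    D.Holds O U (σ.setIdx v a) := by
  refine ⟨?_, ?_, ?_, h.f, h.c, h.y, h.x, h.opened, h.used⟩ <;> rw [State.setIdx_idx, if_neg (by omega)]
  exacts [h.n, h.m, h.N]

theorem Holds.setTab (h : D.Holds O U σ) (a b c : ℕ) (r : ℝ) :
    D.Holds O U (σ.setTab 5 a b c r) := by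
  refine ⟨h.n, h.m, h.N, ?_, ?_, ?_, ?_, ?_, ?_⟩ <;> simp only [State.setTab_tab] <;> norm_num
  exacts [h.f, h.c, h.y, h.x, h.opened, h.used]

theorem Holds.open (h : D.Holds O U σ) (i : ℕ) :
    D.Holds (insert i O) U (σ.setTab 4 i 0 0 1) := by
  refine ⟨h.n, h.m, h.N, ?_, ?_, ?_, ?_, ?_, ?_⟩ <;> simp only [State.setTab_tab] <;> norm_num
  · exact h.f
  · exact h.c
  · exact h.y
  · exact h.x
  · intro i'
    by_cases hi : i' = i <;> simp [hi, h.opened]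
  · exact h.used

theorem Holds.use (h : D.Holds O U σ) (i : ℕ) :
    D.Holds O (insert i U) (σ.setTab 6 i 0 0 1) := by
  refine ⟨h.n, h.m, h.N, ?_, ?_, ?_, ?_, ?_, ?_⟩ <;> simp only [State.setTab_tab] <;> norm_num
  · exact h.f
  · exact h.c
  · exact h.y
  · exact h.x
  · exact h.opened
  · intro i'
    by_cases hi : i' = i <;> simp [hi, h.used]

end Data

namespace Rounding

def openCost (i : ℕ) : RExp := .get 0 (.var i) (.const 0) (.const 0)

def dist (i j : ℕ) : RExp := .get 1 (.var i) (.var j) (.const 0)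

def opening (i : ℕ) : RExp := .get 2 (.var i) (.const 0) (.const 0)

def frac (a i j : ℕ) : RExp := .get 3 (.var a) (.var i) (.var j)

def used (i : ℕ) : RExp := .get 6 (.var i) (.const 0) (.const 0)

def scale : ℕ → RExp → RExp
  | 0, _ => .const 0
  | q + 1, e => .add (scale q e) e

/-- Membership in the ball of a triple. -/
def inBall (a j i₀ i : ℕ) : BExp :=
  .and (.rlt (.const 0) (frac a i j)) (.neg (.rlt (dist i₀ j) (dist i j)))

def before (i i' : ℕ) : BExp :=
  .neg (.and (.neg (.rlt (openCost i) (openCost i')))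
    (.neg (.and (.neg (.rlt (openCost i') (openCost i))) (.nlt (.var i) (.var i')))))

/-- Open all facilities whose scaled opening variable is `1`. -/
def initCmd (k : ℕ) : Cmd :=
  .loop 3 (.var 0) (.ite (.rlt (scale ((k + 1) * (k + 4)) (opening 3)) (.const k)) .skip
    (.seq (.store 4 (.var 3) (.const 0) (.const 0) (.const 1))
      (.store 6 (.var 3) (.const 0) (.const 0) (.const 1))))

def probeStep : Cmd :=
  .seq (.ite (.neg (.rlt (dist 8 7) (dist 10 7)))
    (.store 5 (.const 0) (.const 0) (.const 0)
      (.add (.get 5 (.const 0) (.const 0) (.const 0)) (frac 6 10 7))) .skip)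
  (.ite (.and (inBall 6 7 8 10) (.neg (.rlt (used 10) (.const 1)))) (.assign 9 (.const 1)) .skip)

/-- Compute the mass of a triple, and whether its ball meets the used facilities. -/
def probeCmd : Cmd :=
  .seq (.store 5 (.const 0) (.const 0) (.const 0) (.const 0))
    (.seq (.assign 9 (.const 0)) (.loop 10 (.var 0) probeStep))

def updateCmd (θ : ℚ) : Cmd :=
  .ite (.and (.neg (.rlt (.get 5 (.const 0) (.const 0) (.const 0)) (.const θ)))
      (.and (.nlt (.var 9) (.const 1))
        (.neg (.and (.nlt (.const 0) (.var 5)) (.neg (.rlt (dist 8 7) (dist 13 12)))))))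
    (.seq (.assign 5 (.const 1))
      (.seq (.assign 11 (.var 6)) (.seq (.assign 12 (.var 7)) (.assign 13 (.var 8))))) .skip

/-- Find a heavy triple of smallest radius whose ball does not meet the used facilities. -/
def scanCmd (θ : ℚ) : Cmd :=
  .seq (.assign 5 (.const 0))
    (.loop 6 (.var 2) (.loop 7 (.var 1) (.loop 8 (.var 0) (.seq probeCmd (updateCmd θ)))))

def rankCmd : Cmd :=
  .seq (.assign 15 (.const 0))
    (.loop 16 (.var 0) (.ite (.and (inBall 11 12 13 16) (before 16 14))
      (.assign 15 (.add (.var 15) (.const 1))) .skip))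

/-- Open the cheapest facilities of the ball that was found, and use up the ball. -/
def clusterCmd (q : ℕ) : Cmd :=
  .loop 14 (.var 0) (.ite (inBall 11 12 13 14)
    (.seq rankCmd (.seq
      (.ite (.nlt (.var 15) (.const q))
        (.store 4 (.var 14) (.const 0) (.const 0) (.const 1)) .skip)
      (.store 6 (.var 14) (.const 0) (.const 0) (.const 1)))) .skip)

def roundCmd (θ : ℚ) (q : ℕ) : Cmd :=
  .seq (scanCmd θ) (.ite (.nlt (.const 0) (.var 5)) (clusterCmd q) .skip)

/-- The rounding routine. -/
def routine (k : ℕ) (θ : ℚ) : Cmd :=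
  .seq (initCmd k) (.loop 4 (.var 0) (roundCmd θ (k + 1)))

theorem inputBounded_routine (k : ℕ) (θ : ℚ) : (routine k θ).InputBounded := by
  simp [routine, roundCmd, initCmd, scanCmd, clusterCmd, rankCmd, probeCmd, probeStep, updateCmd,
    Cmd.InputBounded]

variable {D : Data} {O U : Finset ℕ} {σ : State}

theorem eval_scale (q : ℕ) (e : RExp) : (scale q e).eval σ = q * e.eval σ := by
  induction q with
  | zero => simp [scale, RExp.eval]
  | succ q ih => simp [scale, RExp.eval, ih]; ring

theorem eval_inBall (h : D.Holds O U σ) {a j i₀ i : ℕ} (hi : σ.idx i < D.n) :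
    (inBall a j i₀ i).eval σ ↔ σ.idx i ∈ D.ball (σ.idx a, σ.idx j, σ.idx i₀) := by
  simp [inBall, BExp.eval, RExp.eval, NExp.eval, frac, dist, h.x, h.c, Data.ball, hi]

theorem eval_before (h : D.Holds O U σ) (i i' : ℕ) :
    (before i i').eval σ ↔ Before D.f (σ.idx i) (σ.idx i') := by
  simp only [before, BExp.eval, RExp.eval, NExp.eval, openCost, h.f, Before]
  rw [not_and_or, not_not, not_not, not_lt]

theorem run_initCmd {k : ℕ} (h : D.Holds ∅ ∅ σ) :
    D.Holds (D.full k) (D.full k) ((initCmd k).run σ).1 := by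
  have key := Cmd.run_loop_inv (v := 3) (e := .var 0) (σ := σ) (N := D.n) h.n
    (fun s τ => D.Holds {i ∈ D.full k | i < s} {i ∈ D.full k | i < s} τ) (by simpa using h)
    (p := .ite (.rlt (scale ((k + 1) * (k + 4)) (opening 3)) (.const k)) .skip
    (.seq (.store 4 (.var 3) (.const 0) (.const 0) (.const 1))
      (.store 6 (.var 3) (.const 0) (.const 0) (.const 1)))) ?_
  · have : {i ∈ D.full k | i < D.n} = D.full k :=
      filter_true_of_mem fun i hi => mem_range.1 (mem_filter.1 hi).1
    rwa [this] at key
  intro i hi τ hτ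
  have hτ' := hτ.setIdx le_rfl i
  by_cases hb : (BExp.rlt (scale ((k + 1) * (k + 4)) (opening 3)) (.const k)).eval (τ.setIdx 3 i)
  · rw [Cmd.run_ite_pos hb, Cmd.run_skip]
    have hb' : i ∉ D.full k := by
      simp only [BExp.eval, eval_scale, opening, RExp.eval, NExp.eval, State.setIdx_idx,
        State.setIdx_tab, if_true, hτ.y, Rat.cast_natCast] at hb
      simp only [Data.full, mem_filter, not_and, not_le]
      exact fun _ => hb
    convert hτ' using 1 <;>
    · ext i'
      simp only [mem_filter, and_congr_right_iff]
      intro hi'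
      have : i' ≠ i := by rintro rfl; exact hb' hi'
      omega
  · rw [Cmd.run_ite_neg hb]
    have hb' : i ∈ D.full k := by
      simp only [BExp.eval, eval_scale, opening, RExp.eval, NExp.eval, State.setIdx_idx,
        State.setIdx_tab, if_true, hτ.y, Rat.cast_natCast, not_lt] at hb
      simp only [Data.full, mem_filter, mem_range]
      exact ⟨hi, hb⟩
    have hset : {i' ∈ D.full k | i' < i + 1} = insert i {i' ∈ D.full k | i' < i} := by
      ext i'
      simp only [mem_filter, mem_insert, Nat.lt_succ_iff_lt_or_eq]
      constructor
      · tauto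
      · rintro (rfl | h) <;> tauto
    rw [hset]
    simpa [NExp.eval, RExp.eval] using (hτ'.open i).use i

theorem run_probeCmd (h : D.Holds O U σ) {t : ℕ × ℕ × ℕ}
    (ht : (σ.idx 6, σ.idx 7, σ.idx 8) = t) :
    D.Holds O U (probeCmd.run σ).1 ∧ (probeCmd.run σ).1.tab 5 0 0 0 = D.mass t ∧
      ((probeCmd.run σ).1.idx 9 < 1 ↔ ∀ i ∈ D.ball t, i ∉ U) := by
  subst ht
  simp only [probeCmd, Cmd.run_seq, Cmd.run_store, Cmd.run_assign, NExp.eval, RExp.eval]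
  set ρ := (σ.setTab 5 0 0 0 ((0 : ℚ) : ℝ)).setIdx 9 0 with hρ
  have hh : D.Holds O U ρ := (h.setTab _ _ _ _).setIdx (by norm_num) _
  have h6 : ρ.idx 6 = σ.idx 6 := by simp [hρ]
  have h7 : ρ.idx 7 = σ.idx 7 := by simp [hρ]
  have h8 : ρ.idx 8 = σ.idx 8 := by simp [hρ]
  rw [← h6, ← h7, ← h8]
  have key := Cmd.run_loop_inv (v := 10) (e := .var 0) (p := probeStep) (σ := ρ) (N := D.n) hh.n
    (fun s τ => D.Holds O U τ ∧ (τ.idx 6 = ρ.idx 6 ∧ τ.idx 7 = ρ.idx 7 ∧ τ.idx 8 = ρ.idx 8) ∧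
      τ.tab 5 0 0 0 = (∑ i ∈ range s, if D.c i (ρ.idx 7) ≤ D.c (ρ.idx 8) (ρ.idx 7)
        then D.x (ρ.idx 6) i (ρ.idx 7) else 0) ∧
      (τ.idx 9 < 1 ↔ ∀ i ∈ D.ball (ρ.idx 6, ρ.idx 7, ρ.idx 8), i < s → i ∉ U)) ?_ ?_
  · refine ⟨key.1, key.2.2.1, key.2.2.2.trans ?_⟩
    exact forall₂_congr fun i hi => by simp [mem_range.1 (mem_filter.1 hi).1]
  · refine ⟨hh, ⟨rfl, rfl, rfl⟩, ?_, ?_⟩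
    · simp [hρ, State.setTab_tab]
    · simp [hρ]
  rintro i hi τ ⟨hτ, ⟨e6, e7, e8⟩, hm, hd⟩
  simp only [probeStep, Cmd.run_seq]
  set c₁ : Cmd := .ite (.neg (.rlt (dist 8 7) (dist 10 7)))
    (.store 5 (.const 0) (.const 0) (.const 0)
      (.add (.get 5 (.const 0) (.const 0) (.const 0)) (frac 6 10 7))) .skip with hc₁
  have hτ₁ : D.Holds O U (τ.setIdx 10 i) := hτ.setIdx (by norm_num) i
  have h₁ : D.Holds O U (c₁.run (τ.setIdx 10 i)).1 ∧ (c₁.run (τ.setIdx 10 i)).1.tab 5 0 0 0 =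
      ∑ i ∈ range (i + 1), if D.c i (ρ.idx 7) ≤ D.c (ρ.idx 8) (ρ.idx 7)
        then D.x (ρ.idx 6) i (ρ.idx 7) else 0 := by
    rw [sum_range_succ]
    by_cases hb : (BExp.neg (.rlt (dist 8 7) (dist 10 7))).eval (τ.setIdx 10 i)
    · rw [hc₁, Cmd.run_ite_pos hb]
      simp only [BExp.eval, dist, RExp.eval, NExp.eval, hτ₁.c, not_lt] at hb
      simp [e7, e8] at hb
      rw [if_pos hb, Cmd.run_store]
      refine ⟨hτ₁.setTab _ _ _ _, ?_⟩
      simp [NExp.eval, RExp.eval, State.setTab_tab, frac, hm, hτ.x, e6, e7]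
    · rw [hc₁, Cmd.run_ite_neg hb]
      simp only [BExp.eval, dist, RExp.eval, NExp.eval, hτ₁.c, not_lt] at hb
      simp [e7, e8] at hb
      rw [if_neg hb.not_ge, Cmd.run_skip, add_zero]
      exact ⟨hτ₁, hm⟩
  have hidx : ∀ w, (c₁.run (τ.setIdx 10 i)).1.idx w = (τ.setIdx 10 i).idx w :=
    fun w => Cmd.run_idx c₁ rfl _
  generalize (c₁.run (τ.setIdx 10 i)).1 = τ₁ at h₁ hidx
  obtain ⟨h₁, h₁m⟩ := h₁
  have h10 : τ₁.idx 10 = i := by simp [hidx]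
  have e : (τ₁.idx 6, τ₁.idx 7, τ₁.idx 8) = (ρ.idx 6, ρ.idx 7, ρ.idx 8) := by
    simp [hidx, e6, e7, e8]
  have hcond : (BExp.and (inBall 6 7 8 10) (.neg (.rlt (used 10) (.const 1)))).eval τ₁ ↔
      i ∈ D.ball (ρ.idx 6, ρ.idx 7, ρ.idx 8) ∧ i ∈ U := by
    simp only [BExp.eval]
    rw [eval_inBall h₁ (h10.trans_lt hi), e]
    simp only [used, RExp.eval, NExp.eval, h₁.used, h10]
    split_ifs with hU <;> simp [hU]
  simp only [Prod.mk.injEq] at e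
  by_cases hb : (BExp.and (inBall 6 7 8 10) (.neg (.rlt (used 10) (.const 1)))).eval τ₁
  · rw [Cmd.run_ite_pos hb, Cmd.run_assign]
    rw [hcond] at hb
    refine ⟨h₁.setIdx (by norm_num) _, by simpa using e, h₁m, ?_⟩
    simp only [State.setIdx_idx, if_true, NExp.eval, lt_irrefl, false_iff, not_forall]
    exact ⟨i, hb.1, Nat.lt_succ_self i, not_not.2 hb.2⟩
  · rw [Cmd.run_ite_neg hb, Cmd.run_skip]
    rw [hcond] at hb
    refine ⟨h₁, e, h₁m, ?_⟩
    have h9 : τ₁.idx 9 = τ.idx 9 := by simp [hidx]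
    rw [h9, hd]
    refine forall₂_congr fun i' hi' => ⟨fun h hlt => ?_, fun h hlt => h (hlt.trans (Nat.lt_succ_self i))⟩
    rcases Nat.lt_succ_iff_lt_or_eq.1 hlt with hlt | rfl
    · exact h hlt
    · exact fun hU => hb ⟨hi', hU⟩

end Rounding
end RFTFL

namespace RFTFL
open Finset

namespace Rounding

variable {D : Data} {O U : Finset ℕ} {σ : State}

/-- The best triple found so far. -/
def best (σ : State) : ℕ × ℕ × ℕ := (σ.idx 11, σ.idx 12, σ.idx 13)

/-- The triple is a heavy triple whose ball does not meet `U`. -/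
def Eligible (D : Data) (θ : ℝ) (U : Finset ℕ) (t : ℕ × ℕ × ℕ) : Prop :=
  t ∈ D.heavy θ ∧ ∀ i ∈ D.ball t, i ∉ U

/-- The memory during the search for the best triple. -/
def Scanning (D : Data) (θ : ℝ) (O U : Finset ℕ) (σ : State) : Prop :=
  D.Holds O U σ ∧ (0 < σ.idx 5 → Eligible D θ U (best σ))

/-- The search has taken the triple `t` into account. -/
def Scanned (D : Data) (θ : ℝ) (U : Finset ℕ) (t : ℕ × ℕ × ℕ) (σ : State) : Prop :=
  Eligible D θ U t → 0 < σ.idx 5 ∧ D.rad (best σ) ≤ D.rad t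

theorem Scanning.setIdx {θ : ℝ} (h : Scanning D θ O U σ) {v : ℕ} (hv : v = 6 ∨ v = 7 ∨ v = 8)
    (a : ℕ) : Scanning D θ O U (σ.setIdx v a) := by
  rcases hv with rfl | rfl | rfl <;>
    exact ⟨h.1.setIdx (by norm_num) a, by simpa [best] using h.2⟩

theorem Scanned.setIdx {θ : ℝ} {t : ℕ × ℕ × ℕ} (h : Scanned D θ U t σ) {v : ℕ}
    (hv : v = 6 ∨ v = 7 ∨ v = 8) (a : ℕ) : Scanned D θ U t (σ.setIdx v a) := by
  rcases hv with rfl | rfl | rfl <;>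
    simpa [Scanned, best] using h

theorem run_scanBody {θ : ℚ} (h : Scanning D θ O U σ) {t : ℕ × ℕ × ℕ}
    (ht : (σ.idx 6, σ.idx 7, σ.idx 8) = t) (h1 : t.1 < D.N) (h2 : t.2.1 < D.m) (h3 : t.2.2 < D.n) :
    Scanning D θ O U ((Cmd.seq probeCmd (updateCmd θ)).run σ).1 ∧
      Scanned D θ U t ((Cmd.seq probeCmd (updateCmd θ)).run σ).1 ∧
      ∀ t', Scanned D θ U t' σ →
        Scanned D θ U t' ((Cmd.seq probeCmd (updateCmd θ)).run σ).1 := by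
  obtain ⟨hh, hmass, hdisj⟩ := run_probeCmd h.1 ht
  rw [Cmd.run_seq]
  have h5 : (probeCmd.run σ).1.idx 5 = σ.idx 5 := Cmd.run_idx _ rfl _
  have hb : best (probeCmd.run σ).1 = best σ := by
    have e11 : (probeCmd.run σ).1.idx 11 = σ.idx 11 := Cmd.run_idx _ rfl _
    have e12 : (probeCmd.run σ).1.idx 12 = σ.idx 12 := Cmd.run_idx _ rfl _
    have e13 : (probeCmd.run σ).1.idx 13 = σ.idx 13 := Cmd.run_idx _ rfl _
    rw [best, e11, e12, e13, best]
  have ht' : ((probeCmd.run σ).1.idx 6, (probeCmd.run σ).1.idx 7, (probeCmd.run σ).1.idx 8) = t := by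
    have e6 : (probeCmd.run σ).1.idx 6 = σ.idx 6 := Cmd.run_idx _ rfl _
    have e7 : (probeCmd.run σ).1.idx 7 = σ.idx 7 := Cmd.run_idx _ rfl _
    have e8 : (probeCmd.run σ).1.idx 8 = σ.idx 8 := Cmd.run_idx _ rfl _
    rw [e6, e7, e8, ht]
  have hs : Scanning D θ O U (probeCmd.run σ).1 := ⟨hh, by rw [h5, hb]; exact h.2⟩
  have hk : ∀ t', Scanned D θ U t' σ → Scanned D θ U t' (probeCmd.run σ).1 := fun t' h' => by
    rw [Scanned, h5, hb]
    exact h'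
  clear h5 hb h
  generalize (probeCmd.run σ).1 = τ at *
  clear ht
  have hcond : (BExp.and (.neg (.rlt (.get 5 (.const 0) (.const 0) (.const 0)) (.const θ)))
      (.and (.nlt (.var 9) (.const 1))
        (.neg (.and (.nlt (.const 0) (.var 5)) (.neg (.rlt (dist 8 7) (dist 13 12))))))).eval τ ↔
      Eligible D θ U t ∧ ¬ (0 < τ.idx 5 ∧ D.rad (best τ) ≤ D.rad t) := by
    simp only [BExp.eval, RExp.eval, NExp.eval, dist, hmass, hdisj, hh.c, not_lt]
    subst ht'
    simp only [Eligible, Data.heavy, Set.mem_ofPred_eq, Data.rad, best]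
    tauto
  by_cases hc : (BExp.and (.neg (.rlt (.get 5 (.const 0) (.const 0) (.const 0)) (.const θ)))
      (.and (.nlt (.var 9) (.const 1))
        (.neg (.and (.nlt (.const 0) (.var 5)) (.neg (.rlt (dist 8 7) (dist 13 12))))))).eval τ
  · rw [updateCmd, Cmd.run_ite_pos hc]
    rw [hcond] at hc
    simp only [Cmd.run_seq, Cmd.run_assign]
    set τ' := ((((τ.setIdx 5 _).setIdx 11 _).setIdx 12 _).setIdx 13 _) with hτ'
    have hb' : best τ' = t := by
      rw [← ht']
      simp [hτ', best, NExp.eval]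
    have h5' : τ'.idx 5 = 1 := by simp [hτ', NExp.eval]
    refine ⟨⟨?_, fun _ => hb' ▸ hc.1⟩, ?_, ?_⟩
    · exact (((hh.setIdx (by norm_num) _).setIdx (by norm_num) _).setIdx (by norm_num) _).setIdx
        (by norm_num) _
    · intro _
      rw [h5', hb']
      exact ⟨one_pos, le_rfl⟩
    · intro t' h' he
      have h'' := hk t' h' he
      rw [h5', hb']
      refine ⟨one_pos, ?_⟩
      by_contra! hlt
      exact hc.2 ⟨h''.1, h''.2.trans hlt.le⟩
  · rw [updateCmd, Cmd.run_ite_neg hc, Cmd.run_skip]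
    rw [hcond, not_and, not_not] at hc
    exact ⟨hs, hc, hk⟩

theorem run_scanCmd {θ : ℚ} (h : D.Holds O U σ) :
    Scanning D θ O U ((scanCmd θ).run σ).1 ∧
      ∀ t ∈ D.heavy θ, Scanned D θ U t ((scanCmd θ).run σ).1 := by
  have key := Cmd.run_loop_done (v := 6) (e := .var 2)
    (p := .loop 7 (.var 1) (.loop 8 (.var 0) (.seq probeCmd (updateCmd θ))))
    (σ := σ.setIdx 5 0) (N := D.N) (h.setIdx (by norm_num) 0).N (Good := Scanning D θ O U)
    (Done := Scanned D θ U) (T := fun a => {t | t.1 = a ∧ t.2.1 < D.m ∧ t.2.2 < D.n}) ?_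
    ⟨h.setIdx (by norm_num) 0, by simp⟩
  · rw [scanCmd, Cmd.run_seq, Cmd.run_assign]
    exact ⟨key.1, fun t ht => key.2.1 t.1 ht.1 t ⟨rfl, ht.2.1, ht.2.2.1⟩⟩
  intro a ha τ hτ
  have key := Cmd.run_loop_done (v := 7) (e := .var 1)
    (p := .loop 8 (.var 0) (.seq probeCmd (updateCmd θ)))
    (σ := τ.setIdx 6 a) (N := D.m) (hτ.setIdx (by norm_num) a).1.m
    (Good := fun ρ => Scanning D θ O U ρ ∧ ρ.idx 6 = a)
    (Done := Scanned D θ U) (T := fun j => {t | t.1 = a ∧ t.2.1 = j ∧ t.2.2 < D.n}) ?_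
    ⟨hτ.setIdx (by norm_num) a, by simp⟩
  · exact ⟨key.1.1, fun t ht => key.2.1 t.2.1 ht.2.1 t ⟨ht.1, rfl, ht.2.2⟩,
      fun t ht => key.2.2 t (ht.setIdx (by norm_num) a)⟩
  clear hτ τ
  rintro j hj τ ⟨hτ, h6⟩
  have key := Cmd.run_loop_done (v := 8) (e := .var 0) (p := .seq probeCmd (updateCmd θ))
    (σ := τ.setIdx 7 j) (N := D.n) (hτ.setIdx (by norm_num) j).1.n
    (Good := fun ρ => Scanning D θ O U ρ ∧ ρ.idx 6 = a ∧ ρ.idx 7 = j)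
    (Done := Scanned D θ U) (T := fun i => {(a, j, i)}) ?_
    ⟨hτ.setIdx (by norm_num) j, by simp [h6]⟩
  · refine ⟨⟨key.1.1, key.1.2.1⟩, ?_, fun t ht => key.2.2 t (ht.setIdx (by norm_num) j)⟩
    rintro ⟨a', j', i⟩ ⟨rfl, rfl, hi⟩
    exact key.2.1 i hi _ rfl
  clear hτ h6 τ
  rintro i hi τ ⟨hτ, h6, h7⟩
  obtain ⟨k1, k2, k3⟩ := run_scanBody (hτ.setIdx (v := 8) (by norm_num) i) (t := (a, j, i))
    (by simp [h6, h7]) ha hj hi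
  refine ⟨⟨k1, ?_, ?_⟩, ?_, fun t ht => k3 t (ht.setIdx (by norm_num) i)⟩
  · rw [Cmd.run_idx _ rfl]
    simpa using h6
  · rw [Cmd.run_idx _ rfl]
    simpa using h7
  · rintro t rfl
    exact k2

open scoped Classical in
theorem run_rankCmd (h : D.Holds O U σ) :
    D.Holds O U (rankCmd.run σ).1 ∧
      (rankCmd.run σ).1.idx 15 = rank D.f (D.ball (best σ)) (σ.idx 14) := by
  rw [rankCmd, Cmd.run_seq, Cmd.run_assign]
  have h' : D.Holds O U (σ.setIdx 15 0) := h.setIdx (by norm_num) 0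
  have key := Cmd.run_loop_inv (v := 16) (e := .var 0) (N := D.n)
    (p := .ite (.and (inBall 11 12 13 16) (before 16 14))
      (.assign 15 (.add (.var 15) (.const 1))) .skip) (σ := σ.setIdx 15 0) h'.n
    (fun s τ => D.Holds O U τ ∧ best τ = best σ ∧ τ.idx 14 = σ.idx 14 ∧
      τ.idx 15 = #{i ∈ range s | i ∈ D.ball (best σ) ∧ Before D.f i (σ.idx 14)})
    ⟨h', by simp [best], by simp, by simp⟩ ?_
  · refine ⟨key.1, key.2.2.2.trans ?_⟩
    rw [rank]
    congr 1
    ext i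
    simp only [mem_filter, mem_range]
    exact ⟨fun h => h.2, fun h => ⟨mem_range.1 (mem_filter.1 h.1).1, h⟩⟩
  rintro i hi τ ⟨hτ, hb, h14, h15⟩
  have hτ' : D.Holds O U (τ.setIdx 16 i) := hτ.setIdx (by norm_num) i
  have hcond : (BExp.and (inBall 11 12 13 16) (before 16 14)).eval (τ.setIdx 16 i) ↔
      i ∈ D.ball (best σ) ∧ Before D.f i (σ.idx 14) := by
    simp only [BExp.eval]
    rw [eval_inBall hτ' (by simpa using hi), eval_before hτ', ← hb, ← h14]
    simp [best]
  have hb' : best (τ.setIdx 16 i) = best σ := by rw [← hb]; simp [best]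
  rw [range_add_one, filter_insert]
  by_cases hc : (BExp.and (inBall 11 12 13 16) (before 16 14)).eval (τ.setIdx 16 i)
  · rw [Cmd.run_ite_pos hc, Cmd.run_assign, if_pos (hcond.1 hc), card_insert_of_notMem (by simp)]
    refine ⟨hτ'.setIdx (by norm_num) _, ?_, ?_, ?_⟩
    · rw [← hb']; simp [best]
    · simpa using h14
    · simp [NExp.eval, h15]
  · rw [Cmd.run_ite_neg hc, Cmd.run_skip, if_neg (mt hcond.2 hc)]
    exact ⟨hτ', hb', by simpa using h14, by simpa using h15⟩

theorem run_clusterCmd (h : D.Holds O U σ) (q : ℕ) :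
    D.Holds (O ∪ cheapest D.f q (D.ball (best σ))) (U ∪ D.ball (best σ))
      ((clusterCmd q).run σ).1 := by
  set B := D.ball (best σ) with hB
  have hBn : ∀ i ∈ B, i < D.n := fun i hi => mem_range.1 (mem_filter.1 hi).1
  have key := Cmd.run_loop_inv (v := 14) (e := .var 0) (N := D.n)
    (p := .ite (inBall 11 12 13 14)
      (.seq rankCmd (.seq
      (.ite (.nlt (.var 15) (.const q))
        (.store 4 (.var 14) (.const 0) (.const 0) (.const 1)) .skip)
      (.store 6 (.var 14) (.const 0) (.const 0) (.const 1)))) .skip) (σ := σ) h.n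
    (fun s τ => D.Holds (O ∪ {i ∈ cheapest D.f q B | i < s}) (U ∪ {i ∈ B | i < s}) τ ∧
      best τ = best σ) ⟨by simpa using h, rfl⟩ ?_
  · have h1 : {i ∈ B | i < D.n} = B := filter_true_of_mem hBn
    have h2 : {i ∈ cheapest D.f q B | i < D.n} = cheapest D.f q B :=
      filter_true_of_mem fun i hi => hBn i (cheapest_subset _ _ _ hi)
    simp only [h1, h2] at key
    exact key.1
  rintro i hi τ ⟨hτ, hb⟩
  have hτ' := hτ.setIdx (v := 14) (by norm_num) i
  have hb' : best (τ.setIdx 14 i) = best σ := by rw [← hb]; simp [best]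
  have hcond : (inBall 11 12 13 14).eval (τ.setIdx 14 i) ↔ i ∈ B := by
    rw [eval_inBall hτ' (by simpa using hi), hB, ← hb']
    simp [best]
  have hmem : ∀ S : Finset ℕ, i ∈ S → {l ∈ S | l < i + 1} = insert i {l ∈ S | l < i} := by
    intro S hS
    ext l
    simp only [mem_filter, mem_insert, Nat.lt_succ_iff_lt_or_eq]
    constructor
    · tauto
    · rintro (rfl | h) <;> tauto
  have hnot : ∀ S : Finset ℕ, i ∉ S → {l ∈ S | l < i + 1} = {l ∈ S | l < i} := by
    intro S hS
    ext l
    simp only [mem_filter, and_congr_right_iff]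
    intro hl
    have : l ≠ i := by rintro rfl; exact hS hl
    omega
  by_cases hc : (inBall 11 12 13 14).eval (τ.setIdx 14 i)
  · have hiB := hcond.1 hc
    rw [Cmd.run_ite_pos hc, Cmd.run_seq, Cmd.run_seq, hmem B hiB]
    obtain ⟨hr, h15⟩ := run_rankCmd hτ'
    rw [hb', ← hB] at h15
    have hidx : ∀ w, rankCmd.setsIdx w = false →
        (rankCmd.run (τ.setIdx 14 i)).1.idx w = (τ.setIdx 14 i).idx w :=
      fun w hw => Cmd.run_idx _ hw _
    have hbr : best (rankCmd.run (τ.setIdx 14 i)).1 = best σ := by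
      rw [← hb', best, hidx 11 rfl, hidx 12 rfl, hidx 13 rfl, best]
    have h14 : (rankCmd.run (τ.setIdx 14 i)).1.idx 14 = i := by rw [hidx 14 rfl]; simp
    generalize (rankCmd.run (τ.setIdx 14 i)).1 = ρ at *
    simp only [State.setIdx_idx, if_true] at h15
    by_cases hq : (BExp.nlt (.var 15) (.const q)).eval ρ
    · rw [Cmd.run_ite_pos hq]
      simp only [BExp.eval, NExp.eval, h15] at hq
      rw [hmem (cheapest D.f q B) (mem_filter.2 ⟨hiB, hq⟩), union_insert, union_insert]
      simp only [Cmd.run_store, NExp.eval, RExp.eval, h14, State.setTab_idx, Rat.cast_one]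
      exact ⟨(hr.open i).use i, hbr⟩
    · rw [Cmd.run_ite_neg hq, Cmd.run_skip]
      simp only [BExp.eval, NExp.eval, h15] at hq
      rw [hnot (cheapest D.f q B) fun h => hq (mem_filter.1 h).2, union_insert]
      simp only [Cmd.run_store, NExp.eval, RExp.eval, h14, Rat.cast_one]
      exact ⟨hr.use i, hbr⟩
  · have hiB := mt hcond.2 hc
    rw [Cmd.run_ite_neg hc, Cmd.run_skip, hnot B hiB,
      hnot (cheapest D.f q B) fun h => hiB (cheapest_subset _ _ _ h)]
    exact ⟨hτ', hb'⟩

/-- One round either finds that all heavy balls meet the used facilities, or adds a cluster of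
smallest radius. -/
theorem run_roundCmd {θ : ℚ} (h : D.Holds O U σ) (q : ℕ) :
    ((∀ t, ¬ Eligible D θ U t) ∧ D.Holds O U ((roundCmd θ q).run σ).1) ∨
      ∃ t, Eligible D θ U t ∧ (∀ t', Eligible D θ U t' → D.rad t ≤ D.rad t') ∧
        D.Holds (O ∪ cheapest D.f q (D.ball t)) (U ∪ D.ball t) ((roundCmd θ q).run σ).1 := by
  obtain ⟨⟨h1, h2⟩, h3⟩ := run_scanCmd (θ := θ) h
  rw [roundCmd, Cmd.run_seq]
  by_cases hc : (BExp.nlt (.const 0) (.var 5)).eval ((scanCmd θ).run σ).1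
  · rw [Cmd.run_ite_pos hc]
    exact .inr ⟨_, h2 hc, fun t' ht' => (h3 t' ht'.1 ht').2, run_clusterCmd h1 q⟩
  · rw [Cmd.run_ite_neg hc, Cmd.run_skip]
    exact .inl ⟨fun t ht => hc (h3 t ht.1 ht).1, h1⟩

/-- The routine produces a clustering that meets all heavy balls. -/
theorem run_routine {k : ℕ} {θ : ℚ} (hθ : 0 < (θ : ℝ)) (g : ℕ → ℝ) (h : D.Holds ∅ ∅ σ)
    (hf : ∀ i < D.n, 0 ≤ D.f i) (hg0 : ∀ i < D.n, 0 ≤ g i) (hg1 : ∀ i < D.n, g i ≤ 1)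
    (hfull : ∀ i ∈ D.full k, g i = 1)
    (hq : ∀ t ∈ D.heavy θ, (∀ i ∈ D.ball t, i ∉ D.full k) →
      ((k + 1 : ℕ) : ℝ) ≤ ∑ i ∈ D.ball t, g i) :
    ∃ O U, U ⊆ range D.n ∧ D.Holds O U ((routine k θ).run σ).1 ∧
      Clustering D.f g (k + 1) (D.full k) (D.heavy θ) D.ball D.rad O U ∧
      ∀ t ∈ D.heavy θ, ∃ i ∈ D.ball t, i ∈ U := by
  have hne : ∀ t ∈ D.heavy θ, (D.ball t).Nonempty := by
    intro t ht
    by_contra hempty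
    rw [not_nonempty_iff_eq_empty] at hempty
    have hm : D.mass t ≤ 0 := sum_nonpos fun i hi => by
      split_ifs with hc
      · by_contra! hpos
        have : i ∈ D.ball t := mem_filter.2 ⟨hi, hpos, hc⟩
        simp [hempty] at this
      · exact le_rfl
    exact (hθ.trans_le ht.2.2.2).not_ge hm
  have hinit := run_initCmd (k := k) h
  have hfulln : D.full k ⊆ range D.n := filter_subset _ _
  have hball : ∀ t, D.ball t ⊆ range D.n := fun t => filter_subset _ _
  have key := Cmd.run_loop_inv (v := 4) (e := .var 0) (N := D.n) (p := roundCmd θ (k + 1))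
    (σ := ((initCmd k).run σ).1) hinit.n
    (fun s τ => ∃ O U, U ⊆ range D.n ∧ D.Holds O U τ ∧
      Clustering D.f g (k + 1) (D.full k) (D.heavy θ) D.ball D.rad O U ∧
      ((∀ t ∈ D.heavy θ, ∃ i ∈ D.ball t, i ∈ U) ∨ s ≤ #U))
    ⟨_, _, hfulln, hinit, Clustering.init hfull, .inr (Nat.zero_le _)⟩ ?_
  · rw [routine, Cmd.run_seq]
    obtain ⟨O, U, hU, hH, hC, hor⟩ := key
    refine ⟨O, U, hU, hH, hC, hor.elim id fun hn t ht => ?_⟩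
    have hUn : U = range D.n := eq_of_subset_of_card_le hU (by simpa using hn)
    obtain ⟨i, hi⟩ := hne t ht
    exact ⟨i, hi, hUn ▸ hball t hi⟩
  rintro s - τ ⟨O, U, hU, hH, hC, hor⟩
  rcases run_roundCmd (θ := θ) (hH.setIdx (v := 4) (by norm_num) s) (k + 1) with
    ⟨hno, hH'⟩ | ⟨t, ht, hmin, hH'⟩
  · refine ⟨O, U, hU, hH', hC, .inl fun t ht => ?_⟩
    by_contra! hc
    exact hno t ⟨ht, hc⟩
  · have hbn : ∀ i ∈ D.ball t, i < D.n := fun i hi => mem_range.1 (hball t hi)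
    refine ⟨_, _, union_subset hU (hball t), hH', hC.step ht.1 ht.2
      (fun t' h1 h2 => hmin t' ⟨h1, h2⟩) (fun i hi => hf i (hbn i hi))
      (fun i hi => hg0 i (hbn i hi)) (fun i hi => hg1 i (hbn i hi))
      (hq t ht.1 fun i hi hL => ht.2 i hi (hC.sub (hC.full hL))), .inr ?_⟩
    have hs : s ≤ #U := hor.resolve_left fun hall => by
      obtain ⟨i, hi, hiU⟩ := hall t ht.1
      exact ht.2 i hi hiU
    rw [card_union_of_disjoint (disjoint_left.2 fun i hi hi' => ht.2 i hi' hi)]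
    have := card_pos.2 (hne t ht.1)
    omega

end Rounding
end RFTFL

namespace RFTFL
open Finset

/-- Some point at distance at most `(∑ c w) / (1 - θ)` has a ball of weight at least `θ`. -/
theorem exists_quantile {F : Type*} [Fintype F] {c w : F → ℝ} {θ : ℝ} (hc : ∀ i, 0 ≤ c i)
    (hw : ∀ i, 0 ≤ w i) (hw1 : 1 ≤ ∑ i, w i) (h0 : 0 < θ) (h1 : θ < 1) :
    ∃ i₀, (1 - θ) * c i₀ ≤ ∑ i, c i * w i ∧ θ ≤ ∑ i, if c i ≤ c i₀ then w i else 0 := by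
  have hθ : 0 < 1 - θ := sub_pos.2 h1
  set r := (∑ i, c i * w i) / (1 - θ) with hr
  have hr0 : 0 ≤ r := div_nonneg (sum_nonneg fun i _ => mul_nonneg (hc i) (hw i)) hθ.le
  have hmass : θ ≤ ∑ i with c i ≤ r, w i := by
    by_contra! hlt
    have hsplit := sum_filter_add_sum_filter_not univ (fun i => c i ≤ r) w
    have hsplit' := sum_filter_add_sum_filter_not univ (fun i => c i ≤ r) fun i => c i * w i
    have hfar : 1 - θ < ∑ i with ¬ c i ≤ r, w i := by linarith
    obtain ⟨i, hi, hpos⟩ := exists_lt_of_sum_lt (f := fun _ => (0 : ℝ)) (g := w)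
      (by rw [sum_const_zero]; exact hθ.trans hfar)
    have hstrict : ∑ i with ¬ c i ≤ r, r * w i < ∑ i with ¬ c i ≤ r, c i * w i := by
      refine sum_lt_sum (fun l hl => ?_) ⟨i, hi, ?_⟩
      · exact mul_le_mul_of_nonneg_right (not_le.1 (mem_filter.1 hl).2).le (hw l)
      · exact mul_lt_mul_of_pos_right (not_le.1 (mem_filter.1 hi).2) hpos
    have hnear : 0 ≤ ∑ i with c i ≤ r, c i * w i :=
      sum_nonneg fun i _ => mul_nonneg (hc i) (hw i)
    rw [← mul_sum] at hstrict
    have hle := mul_le_mul_of_nonneg_left hfar.le hr0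
    rw [hr, div_mul_cancel₀ _ hθ.ne', ← hr] at hle
    linarith
  have hne : (univ.filter fun i => c i ≤ r).Nonempty := by
    by_contra hempty
    rw [not_nonempty_iff_eq_empty] at hempty
    rw [hempty, sum_empty] at hmass
    exact h0.not_ge hmass
  obtain ⟨i₀, hi₀, hmax⟩ := exists_max_image _ c hne
  have hi₀r := (mem_filter.1 hi₀).2
  refine ⟨i₀, ?_, ?_⟩
  · have := mul_le_mul_of_nonneg_left hi₀r hθ.le
    rwa [hr, mul_div_cancel₀ _ hθ.ne'] at this
  · rw [← sum_filter]
    convert hmass using 3 with i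
    exact ⟨fun h => h.trans hi₀r, fun h => hmax i (mem_filter.2 ⟨mem_univ _, h⟩)⟩

theorem ratio_eq {k : ℕ} (hk : 1 ≤ k) : ratio k = (k + 1) * (k + 4) / k := by
  have : (k : ℝ) ≠ 0 := by positivity
  rw [ratio]
  field_simp
  ring

theorem ratio_pos {k : ℕ} (hk : 1 ≤ k) : 0 < ratio k := by
  have : (0 : ℝ) < k := by exact_mod_cast hk
  rw [ratio]
  positivity

namespace Instance

variable {F C : Type} (I : Instance F C)

theorem c_nonneg (i : F) (j : C) : 0 ≤ I.c i j := by
  obtain ⟨d, hd⟩ := I.metric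
  rw [hd]
  exact dist_nonneg

theorem c_le (i l : F) (j j' : C) : I.c l j ≤ I.c l j' + I.c i j' + I.c i j := by
  obtain ⟨d, hd⟩ := I.metric
  simp only [hd]
  have h1 := dist_triangle (Sum.inl l : F ⊕ C) (Sum.inr j') (Sum.inr j)
  have h2 := dist_triangle_left (Sum.inr j' : F ⊕ C) (Sum.inr j) (Sum.inl i)
  linarith

variable {I} [Fintype F] {k : ℕ} {x : Scenario F k → F → C → ℝ} {y : F → ℝ}

theorem LPFeasible.fracCost_nonneg (h : I.LPFeasible k x y) (A : Scenario F k) (j : C) :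
    0 ≤ I.fracCost x A j :=
  sum_nonneg fun i _ => mul_nonneg (I.c_nonneg i j) (h.x_nonneg A i j)

variable [DecidableEq F] [Fintype C]

/-- If every client keeps a facility within `γ` times its fractional cost, then the cost is at most
`γ` times that of the fractional solution. -/
theorem robustCost_le (hk : k ≤ Fintype.card F) (h : I.LPFeasible k x y) {γ : ℝ} (hγ : 0 ≤ γ)
    {S : Finset F} (hS : ∑ i ∈ S, I.f i ≤ ∑ i, I.f i * min 1 (γ * y i))
    (hnear : ∀ (A : Scenario F k) (j : C), ∃ i ∈ S, i ∉ A.1 ∧ I.c i j ≤ γ * I.fracCost x A j) :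
    I.robustCost k S ≤ ENNReal.ofReal (γ * I.lpCost x y) := by
  have hf : ∑ i ∈ S, I.f i ≤ γ * ∑ i, I.f i * y i := by
    refine hS.trans ?_
    rw [mul_sum]
    refine sum_le_sum fun i _ => ?_
    rw [mul_left_comm]
    exact mul_le_mul_of_nonneg_left (min_le_right _ _) (I.f_nonneg i)
  have hsup : 0 ≤ ⨆ A : Scenario F k, ∑ j, I.fracCost x A j :=
    Real.iSup_nonneg fun A => sum_nonneg fun j _ => h.fracCost_nonneg A j
  rw [lpCost, mul_add, ENNReal.ofReal_add
    ((sum_nonneg fun i _ => I.f_nonneg i).trans hf) (mul_nonneg hγ hsup), robustCost]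
  refine add_le_add ?_ (iSup₂_le fun A hA => ?_)
  · rw [← ENNReal.ofReal_sum_of_nonneg fun i _ => I.f_nonneg i]
    exact ENNReal.ofReal_le_ofReal hf
  · obtain ⟨A', hAA', -, hA'⟩ := exists_subsuperset_card_eq (subset_univ A) hA.2 hk
    set B : Scenario F k := ⟨A', hA'⟩
    calc ∑ j : C, ⨅ i ∈ S \ A, ENNReal.ofReal (I.c i j)
        ≤ ∑ j : C, ENNReal.ofReal (γ * I.fracCost x B j) := by
          refine sum_le_sum fun j _ => ?_
          obtain ⟨i, hi, hiA, hc⟩ := hnear B j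
          exact (iInf₂_le i (mem_sdiff.2 ⟨hi, fun h => hiA (hAA' h)⟩)).trans
            (ENNReal.ofReal_le_ofReal hc)
      _ = ENNReal.ofReal (γ * ∑ j, I.fracCost x B j) := by
          rw [mul_sum, ENNReal.ofReal_sum_of_nonneg]
          exact fun j _ => mul_nonneg hγ (h.fracCost_nonneg B j)
      _ ≤ _ := ENNReal.ofReal_le_ofReal (mul_le_mul_of_nonneg_left
          (le_ciSup (f := fun A : Scenario F k => ∑ j, I.fracCost x A j)
            (Set.finite_range _).bddAbove B) hγ)

/-- The linear program is a relaxation. -/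
theorem exists_lpFeasible_le_robustCost (hk : k ≤ Fintype.card F) {S : Finset F}
    (hS : I.robustCost k S ≠ ⊤) :
    ∃ (x : Scenario F k → F → C → ℝ) (y : F → ℝ), I.LPFeasible k x y ∧
      ENNReal.ofReal (I.lpCost x y) ≤ I.robustCost k S := by
  have hne : ∀ (A : Scenario F k) (_ : C), (S \ A.1).Nonempty := by
    intro A j
    by_contra hempty
    rw [not_nonempty_iff_eq_empty, sdiff_eq_empty_iff_subset] at hempty
    refine hS (top_unique ?_)
    rw [robustCost]
    refine le_add_left (le_trans ?_ (le_iSup₂ S ⟨subset_rfl, (card_le_card hempty).trans A.2.le⟩))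
    rw [sdiff_self]
    refine le_trans ?_ (single_le_sum (fun _ _ => zero_le) (mem_univ j))
    simp
  have hex : ∀ (A : Scenario F k) (j : C), ∃ i ∈ S \ A.1, ∀ i' ∈ S \ A.1, I.c i j ≤ I.c i' j :=
    fun A j => exists_min_image _ _ (hne A j)
  choose near hmem hmin using hex
  refine ⟨fun A i j => if i = near A j then 1 else 0, fun i => if i ∈ S then 1 else 0, ?_, ?_⟩
  · refine ⟨fun A j => by simp, fun A i j => ?_, fun A i hi j => ?_, fun A i j => ?_, fun i => ?_⟩
    · by_cases h : i = near A j
      · simp [h, (mem_sdiff.1 (hmem A j)).1]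
      · simp only [h, if_false]
        split_ifs <;> norm_num
    · refine if_neg ?_
      rintro rfl
      exact (mem_sdiff.1 (hmem A j)).2 hi
    · split_ifs <;> norm_num
    · split_ifs <;> norm_num
  · have : Nonempty (Scenario F k) := by
      obtain ⟨A, -, hA⟩ := exists_subset_card_eq (s := (univ : Finset F)) hk
      exact ⟨⟨A, hA⟩⟩
    have hfrac : ∀ (A : Scenario F k) (j : C),
        I.fracCost (fun A i j => if i = near A j then 1 else 0) A j = I.c (near A j) j := by
      intro A j
      simp [fracCost]
    obtain ⟨A, hA⟩ := exists_eq_ciSup_of_finite (f := fun A : Scenario F k =>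
      ∑ j, I.fracCost (fun A i j => if i = near A j then 1 else 0) A j)
    rw [lpCost, ← hA]
    simp only [hfrac, mul_ite, mul_one, mul_zero, sum_ite_mem, univ_inter]
    rw [ENNReal.ofReal_add (sum_nonneg fun i _ => I.f_nonneg i)
      (sum_nonneg fun j _ => I.c_nonneg _ j), robustCost,
      ENNReal.ofReal_sum_of_nonneg fun i _ => I.f_nonneg i,
      ENNReal.ofReal_sum_of_nonneg fun j _ => I.c_nonneg _ j]
    have hAS : A.1 ∩ S ⊆ S ∧ #(A.1 ∩ S) ≤ k :=
      ⟨inter_subset_right, (card_le_card inter_subset_left).trans A.2.le⟩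
    refine add_le_add le_rfl (le_trans (sum_le_sum fun j _ => ?_)
      (le_iSup₂ (f := fun (A : Finset F) (_ : A ⊆ S ∧ #A ≤ k) =>
        ∑ j : C, ⨅ i ∈ S \ A, ENNReal.ofReal (I.c i j)) (A.1 ∩ S) hAS))
    refine le_iInf₂ fun i hi => ENNReal.ofReal_le_ofReal (hmin A j i ?_)
    simp only [mem_sdiff, mem_inter, not_and] at hi ⊢
    exact ⟨hi.1, fun h => hi.2 h hi.1⟩

theorem LPOptimal.ofReal_lpCost_le_opt (hk : k ≤ Fintype.card F) (h : I.LPOptimal k x y) :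
    ENNReal.ofReal (I.lpCost x y) ≤ I.opt k := by
  refine le_iInf fun S => ?_
  by_cases hS : I.robustCost k S = ⊤
  · rw [hS]
    exact le_top
  · obtain ⟨x', y', hf, hle⟩ := exists_lpFeasible_le_robustCost hk hS
    exact (ENNReal.ofReal_le_ofReal (h.2 x' y' hf)).trans hle

end Instance

end RFTFL

namespace RFTFL
open Finset

/-- The fraction of the demand that has to be served in a cluster: `1 - 3 / ratio k`. -/
def threshold (k : ℕ) : ℚ := 1 - 3 * k / ((k + 1) * (k + 4))

theorem ratio_mul_threshold {k : ℕ} (hk : 1 ≤ k) :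
    ratio k * (1 - (threshold k : ℝ)) = 3 ∧ 0 < (threshold k : ℝ) ∧ (threshold k : ℝ) < 1 := by
  have hk0 : (0 : ℝ) < k := by exact_mod_cast hk
  have h : (threshold k : ℝ) = 1 - 3 * k / ((k + 1) * (k + 4)) := by
    simp [threshold]
  rw [h, ratio_eq hk]
  refine ⟨by field_simp; ring, ?_, ?_⟩
  · rw [sub_pos, div_lt_one (by positivity)]
    nlinarith
  · have : 0 < 3 * (k : ℝ) / ((k + 1) * (k + 4)) := by positivity
    linarith

theorem le_ratio_mul_threshold {k : ℕ} (hk : 1 ≤ k) :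
    ((k + 1 : ℕ) : ℝ) ≤ ratio k * threshold k := by
  have h := (ratio_mul_threshold hk).1
  have h4 : 0 ≤ 4 / (k : ℝ) := by positivity
  have hr : ratio k = (k : ℝ) + 5 + 4 / (k : ℝ) := rfl
  push_cast
  linarith

namespace Instance

variable {n m k : ℕ} {I : Instance (Fin n) (Fin m)} {e : Fin (n.choose k) ≃ Scenario (Fin n) k}
  {x : Scenario (Fin n) k → Fin n → Fin m → ℝ} {y : Fin n → ℝ}

/-- The data that the input memory contains. -/
noncomputable def data (I : Instance (Fin n) (Fin m)) (e : Fin (n.choose k) ≃ Scenario (Fin n) k)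
    (x : Scenario (Fin n) k → Fin n → Fin m → ℝ) (y : Fin n → ℝ) : Data where
  n := n
  m := m
  N := n.choose k
  f i := (encode I e x y).tab 0 i 0 0
  c i j := (encode I e x y).tab 1 i j 0
  y i := (encode I e x y).tab 2 i 0 0
  x a i j := (encode I e x y).tab 3 a i j

theorem holds_encode : (I.data e x y).Holds ∅ ∅ (encode I e x y) := by
  refine ⟨rfl, rfl, rfl, fun _ => rfl, fun _ _ => rfl, fun _ => rfl, fun _ _ _ => rfl, ?_, ?_⟩ <;>
    simp [encode]

theorem data_f (i : Fin n) : (I.data e x y).f i = I.f i := by simp [data, encode]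

theorem data_c (i : Fin n) (j : Fin m) : (I.data e x y).c i j = I.c i j := by simp [data, encode]

theorem data_y (i : Fin n) : (I.data e x y).y i = y i := by simp [data, encode]

theorem data_x (a : Fin (n.choose k)) (i : Fin n) (j : Fin m) :
    (I.data e x y).x a i j = x (e a) i j := by simp [data, encode]

theorem mem_full_iff (hk : 1 ≤ k) (i : Fin n) :
    (i : ℕ) ∈ (I.data e x y).full k ↔ 1 ≤ ratio k * y i := by
  have hk0 : (0 : ℝ) < k := by exact_mod_cast hk
  simp only [Data.full, mem_filter, mem_range, data_y]
  rw [ratio_eq hk, div_mul_eq_mul_div, one_le_div hk0]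
  push_cast
  exact ⟨And.right, fun h => ⟨i.2, h⟩⟩

theorem mem_ball_iff {a : Fin (n.choose k)} {j : Fin m} {i₀ i : Fin n} :
    (i : ℕ) ∈ (I.data e x y).ball (a, j, i₀) ↔ 0 < x (e a) i j ∧ I.c i j ≤ I.c i₀ j := by
  simp only [Data.ball, mem_filter, mem_range, data_x, data_c]
  exact ⟨And.right, fun h => ⟨i.2, h⟩⟩

/-- A heavy cluster without fully open facilities has opening weight at least `k + 1`. -/
theorem LPFeasible.le_sum_ball (hk : 1 ≤ k) (h : I.LPFeasible k x y) {t : ℕ × ℕ × ℕ}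
    (ht : t ∈ (I.data e x y).heavy (threshold k))
    (hfull : ∀ i ∈ (I.data e x y).ball t, i ∉ (I.data e x y).full k) :
    ((k + 1 : ℕ) : ℝ) ≤
      ∑ i ∈ (I.data e x y).ball t, min 1 (ratio k * (I.data e x y).y i) := by
  obtain ⟨a, j, i₀⟩ := t
  obtain ⟨ha, hj, hi₀, hmass⟩ := ht
  lift a to Fin (n.choose k) using ha
  lift j to Fin m using hj
  lift i₀ to Fin n using hi₀
  have hr := ratio_pos hk
  refine (le_ratio_mul_threshold hk).trans ((mul_le_mul_of_nonneg_left hmass hr.le).trans ?_)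
  rw [Data.mass, mul_sum, Data.ball, sum_filter]
  refine sum_le_sum fun i hi => ?_
  have hi : i < n := mem_range.1 hi
  lift i to Fin n using hi
  have hfi := hfull i
  rw [mem_ball_iff, mem_full_iff hk] at hfi
  simp only [Data.rad, data_c, data_x, data_y]
  have hx := h.x_nonneg (e a) i j
  by_cases hc : I.c i j ≤ I.c i₀ j
  · rcases hx.eq_or_lt with h0 | hpos
    · simp [← h0]
    · rw [if_pos hc, if_pos ⟨hpos, hc⟩, min_eq_right (not_le.1 (hfi ⟨hpos, hc⟩)).le]
      exact mul_le_mul_of_nonneg_left (h.le_open _ _ _) hr.le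
  · simp [hc]

/-- Every client has a heavy cluster of small radius in every scenario. -/
theorem LPFeasible.exists_heavy (hk : 1 ≤ k) (h : I.LPFeasible k x y) (A : Scenario (Fin n) k)
    (j : Fin m) : ∃ i₀ : Fin n, ((e.symm A : ℕ), (j : ℕ), (i₀ : ℕ)) ∈
      (I.data e x y).heavy (threshold k) ∧ I.c i₀ j ≤ ratio k / 3 * I.fracCost x A j := by
  obtain ⟨hr, h0, h1⟩ := ratio_mul_threshold hk
  obtain ⟨i₀, hi₀, hm⟩ := exists_quantile (c := fun i => I.c i j) (w := fun i => x A i j)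
    (fun i => I.c_nonneg i j) (fun i => h.x_nonneg A i j) (h.cover A j) h0 h1
  refine ⟨i₀, ⟨(e.symm A).2, j.2, i₀.2, ?_⟩, ?_⟩
  · change (threshold k : ℝ) ≤ ∑ i ∈ range n, _
    rw [sum_range]
    simpa [Data.rad, data_c, data_x] using hm
  · have := mul_le_mul_of_nonneg_left hi₀ (ratio_pos hk).le
    rw [← mul_assoc, hr] at this
    rw [fracCost]
    linarith

/-- The routine opens a set with the required properties. -/
theorem LPFeasible.routine_spec (hk : 1 ≤ k) (h : I.LPFeasible k x y) {S : Finset (Fin n)}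
    (hS : S = output n ((Rounding.routine k (threshold k)).run (encode I e x y)).1) :
    ∑ i ∈ S, I.f i ≤ ∑ i, I.f i * min 1 (ratio k * y i) ∧
      ∀ (A : Scenario (Fin n) k) (j : Fin m),
        (∃ i ∈ S, i ∉ A.1 ∧ min 1 (ratio k * y i) = 1 ∧
          I.c i j ≤ ratio k / 3 * I.fracCost x A j) ∨
        k + 1 ≤ #{i ∈ S | I.c i j ≤ ratio k * I.fracCost x A j} := by
  set D := I.data e x y with hD
  have hr := ratio_pos hk
  have hg0 : ∀ i < n, 0 ≤ min 1 (ratio k * D.y i) := by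
    intro i hi
    lift i to Fin n using hi
    rw [hD, data_y]
    exact le_min zero_le_one (mul_nonneg hr.le (h.y_nonneg i))
  have hf : ∀ i < n, 0 ≤ D.f i := by
    intro i hi
    lift i to Fin n using hi
    rw [hD, data_f]
    exact I.f_nonneg i
  have hfull : ∀ i ∈ D.full k, min 1 (ratio k * D.y i) = 1 := by
    intro i hi
    have hin : i < n := mem_range.1 (mem_filter.1 hi).1
    lift i to Fin n using hin
    rw [hD, data_y]
    exact min_eq_left ((mem_full_iff hk i).1 hi)
  obtain ⟨O, U, hU, hH, hC, hhit⟩ := Rounding.run_routine (k := k) (θ := threshold k)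
    (ratio_mul_threshold hk).2.1 (fun i => min 1 (ratio k * D.y i))
    (holds_encode (I := I) (e := e) (x := x) (y := y)) hf hg0 (fun i _ => min_le_left _ _) hfull
    (fun t ht hfull => h.le_sum_ball hk ht hfull)
  have hmem : ∀ i : Fin n, i ∈ S ↔ (i : ℕ) ∈ O := by
    intro i
    rw [hS, output, mem_filter, hH.opened]
    simp
  have hOn : O ⊆ range n := hC.sub.trans hU
  have hmap : S.map Fin.valEmbedding = O := by
    ext i
    simp only [mem_map, Fin.valEmbedding_apply, hmem]
    constructor
    · rintro ⟨i, hi, rfl⟩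
      exact hi
    · intro hi
      exact ⟨⟨i, mem_range.1 (hOn hi)⟩, hi, rfl⟩
  refine ⟨?_, fun A j => ?_⟩
  · calc ∑ i ∈ S, I.f i = ∑ i ∈ O, D.f i := by
          rw [← hmap, sum_map]
          exact sum_congr rfl fun i _ => (data_f i).symm
      _ ≤ ∑ i ∈ U, D.f i * min 1 (ratio k * D.y i) := hC.cost
      _ ≤ ∑ i ∈ range n, D.f i * min 1 (ratio k * D.y i) :=
          sum_le_sum_of_subset_of_nonneg hU fun i hi _ =>
            mul_nonneg (hf i (mem_range.1 hi)) (hg0 i (mem_range.1 hi))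
      _ = ∑ i, I.f i * min 1 (ratio k * y i) := by
          rw [sum_range]
          exact sum_congr rfl fun i _ => by rw [hD, data_f, data_y]
  · obtain ⟨i₀, ht, hrad⟩ := h.exists_heavy (e := e) hk A j
    rcases hC.near _ ht (hhit _ ht) with ⟨i, hi, hiL⟩ | ⟨⟨a', j', i'⟩, ht', hle, ⟨i, hi, hi'⟩, hcard⟩
    · have hin : i < n := mem_range.1 (mem_filter.1 hi).1
      lift i to Fin n using hin
      rw [mem_ball_iff, Equiv.apply_symm_apply] at hi
      refine .inl ⟨i, (hmem i).2 (hC.full hiL), fun hA => ?_,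
        min_eq_left ((mem_full_iff hk i).1 hiL), hi.2.trans hrad⟩
      exact hi.1.ne' (h.closed A i hA j)
    · refine .inr (hcard.trans ?_)
      obtain ⟨ha', hj', hi₀', -⟩ := ht'
      lift a' to Fin (n.choose k) using ha'
      lift j' to Fin m using hj'
      lift i' to Fin n using hi₀'
      have hin : i < n := mem_range.1 (mem_filter.1 hi).1
      lift i to Fin n using hin
      simp only [Data.rad, data_c] at hle
      rw [mem_ball_iff] at hi hi'
      rw [← card_map Fin.valEmbedding]
      refine card_le_card fun l hl => ?_
      obtain ⟨hlO, hlB⟩ := mem_inter.1 hl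
      have hln : l < n := mem_range.1 (hOn hlO)
      lift l to Fin n using hln
      rw [mem_ball_iff] at hlB
      refine mem_map.2 ⟨l, mem_filter.2 ⟨(hmem l).2 hlO, ?_⟩, rfl⟩
      have := I.c_le i l j j'
      linarith [hi.2, hi'.2, hlB.2]

end Instance

end RFTFL

theorem mainTheorem6 (k : ℕ) (hk : 1 ≤ k) :
    ∃ (P : RFTFL.Cmd) (p : Polynomial ℕ),
      ∀ (n m : ℕ) (_ : k < n) (I : RFTFL.Instance (Fin n) (Fin m))
        (e : Fin (n.choose k) ≃ RFTFL.Scenario (Fin n) k)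
        (x : RFTFL.Scenario (Fin n) k → Fin n → Fin m → ℝ) (y : Fin n → ℝ),
        I.LPFeasible k x y →
        -- the routine makes polynomially many steps and opens a set `S`
        (P.run (RFTFL.encode I e x y)).2 ≤ p.eval (n + m) ∧
        ∃ S : Finset (Fin n), S = RFTFL.output n (P.run (RFTFL.encode I e x y)).1 ∧
          -- the opening cost is at most that of the scaled opening variables
          ∑ i ∈ S, I.f i ≤ ∑ i, I.f i * min 1 (RFTFL.ratio k * y i) ∧
          -- an open surviving facility with full scaled opening, or `k + 1` open facilities nearby
          (∀ (A : RFTFL.Scenario (Fin n) k) (j : Fin m),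
            (∃ i ∈ S, i ∉ A.1 ∧ min 1 (RFTFL.ratio k * y i) = 1 ∧
              I.c i j ≤ RFTFL.ratio k / 3 * I.fracCost x A j) ∨
            k + 1 ≤ (S.filter fun i => I.c i j ≤ RFTFL.ratio k * I.fracCost x A j).card) ∧
          -- every client keeps a nearby open facility in every scenario
          (∀ (A : RFTFL.Scenario (Fin n) k) (j : Fin m),
            ∃ i ∈ S, i ∉ A.1 ∧ I.c i j ≤ RFTFL.ratio k * I.fracCost x A j) ∧
          -- approximation guarantees
          I.robustCost k S ≤ ENNReal.ofReal (RFTFL.ratio k * I.lpCost x y) ∧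
          (I.LPOptimal k x y →
            I.robustCost k S ≤ ENNReal.ofReal (RFTFL.ratio k) * I.opt k) := by
  refine ⟨RFTFL.Rounding.routine k (RFTFL.threshold k),
    (RFTFL.Rounding.routine k (RFTFL.threshold k)).timePoly.comp
      (Polynomial.X + Polynomial.X ^ k), fun n m hn I e x y h => ⟨?_, _, rfl, ?_⟩⟩
  · rw [Polynomial.eval_comp, Polynomial.eval_add, Polynomial.eval_pow, Polynomial.eval_X]
    refine RFTFL.Cmd.run_time_le (RFTFL.Rounding.inputBounded_routine _ _) fun u hu => ?_
    have hc : n.choose k ≤ (n + m) ^ k :=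
      (Nat.choose_le_pow n k).trans (Nat.pow_le_pow_left (Nat.le_add_right n m) k)
    interval_cases u
    · change n ≤ _
      omega
    · change m ≤ _
      omega
    · change n.choose k ≤ _
      omega
  · obtain ⟨h1, h2⟩ := h.routine_spec (e := e) hk rfl
    generalize RFTFL.output n
      ((RFTFL.Rounding.routine k (RFTFL.threshold k)).run (RFTFL.encode I e x y)).1 = S at *
    have hr := RFTFL.ratio_pos hk
    have hkn : k ≤ Fintype.card (Fin n) := by simpa using hn.le
    have h3 : ∀ (A : RFTFL.Scenario (Fin n) k) (j : Fin m),
        ∃ i ∈ S, i ∉ A.1 ∧ I.c i j ≤ RFTFL.ratio k * I.fracCost x A j := by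
      intro A j
      rcases h2 A j with ⟨i, hi, hiA, -, hc⟩ | hcard
      · refine ⟨i, hi, hiA, hc.trans ?_⟩
        have := mul_nonneg hr.le (h.fracCost_nonneg A j)
        linarith
      · obtain ⟨i, hi, hiA⟩ := Finset.exists_mem_notMem_of_card_lt_card
          ((A.2.trans_lt (Nat.lt_succ_self k)).trans_le hcard)
        exact ⟨i, (Finset.mem_filter.1 hi).1, hiA, (Finset.mem_filter.1 hi).2⟩
    have h4 := RFTFL.Instance.robustCost_le hkn h hr.le h1 h3
    refine ⟨h1, h2, h3, h4, fun hopt => h4.trans ?_⟩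
    rw [ENNReal.ofReal_mul hr.le]
    exact mul_le_mul_right (hopt.ofReal_lpCost_le_opt hkn) _
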